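/- Let $d\ge 2$ and let $\Omega\subset\mathbb R^d$ be compact and connected, with nonempty interior $\Omega^{\mathrm o}$ and smooth connected boundary $\partial\Omega$. Let $\lambda$ be Lebesgue measure on $\Omega^{\mathrm o}$, $\sigma$ the surface measure on $\partial\Omega$, and $\nabla^\tau$ the tangential gradient on $\partial\Omega$. Let $a>0$ and $\rho=\omega\lambda+\gamma\sigma$, where $\omega\in L^1(\lambda)$, $\gamma\in L^1(\sigma)$ are a.e. positive densities with $1/\omega\in L^1(\lambda)$, $1/\gamma\in L^1(\sigma)$ (for example, densities bounded below by positive constants; $\rho$ need not be normalized). A perturbation is a pair $s=(s_{\mathrm o},s_\partial)$ of linear functionals on $C^\infty(\Omega)$ and $C^\infty(\partial\Omega)$ respectively (for example, finite signed measures on $\Omega^{\mathrm o}$ and $\partial\Omega$). A pair $V=(V_{\mathrm o},V_\partial)$ of vector fields, with $\omega V_{\mathrm o}\in L^1(\lambda)$, $\gamma V_\partial\in L^1(\sigma)$ and $V_\partial$ tangent to $\partial\Omega$ a.e., represents $s$ if $$s_{\mathrm o}=-\operatorname{div}(\omega V_{\mathrm o})\ \text{ in }\Omega^{\mathrm o},\qquad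 s_\partial=-\operatorname{div}^\tau(\gamma V_\partial)+\omega V_{\mathrm o}\cdot N\ \text{ on }\partial\Omega$$ in the weak sense, that is, for all $\xi\in C^\infty(\Omega)$, $$\langle s_{\mathrm o},\xi\rangle+\langle s_\partial,\xi|_{\partial\Omega}\rangle=\int_{\Omega^{\mathrm o}}\omega V_{\mathrm o}\cdot\nabla\xi\,d\lambda+\int_{\partial\Omega}\gamma V_\partial\cdot\nabla^\tau\xi\,d\sigma .$$ Its kinetic energy is $\|V\|_\rho^2=\int_{\Omega^{\mathrm o}}|V_{\mathrm o}|^2\omega\,d\lambda+\frac1a\int_{\partial\Omega}|V_\partial|^2\gamma\,d\sigma\in[0,\infty]$. The energy space consists of the functions $\phi\in L^1(\lambda+\sigma)$ on $\Omega$ for which there are $\xi_n\in C^\infty(\Omega)$ with $\xi_n\to\phi$ in $L^1(\lambda)$ and in $L^1(\sigma)$ such that $\nabla\xi_n$ converges in $L^2(\omega\lambda)$ and $\nabla^\tau\xi_n$ converges in $L^2(\gamma\sigma)$; the limits are $\nabla\phi$ and $\nabla^\tau\phi$. In particular $\phi|_{\partial\Omega}$ is the trace of $\phi|_{\Omega^{\mathrm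 o}}$. Put $\|\phi\|_\rho^2=\int_{\Omega^{\mathrm o}}|\nabla\phi|^2\omega\,d\lambda+a\int_{\partial\Omega}|\nabla^\tau\phi|^2\gamma\,d\sigma$. Suppose that $s$ is represented by at least one pair $V$ with $\|V\|_\rho<\infty$. Then the coupled system $$s_{\mathrm o}=-\operatorname{div}(\omega\nabla\phi)\ \text{ in }\Omega^{\mathrm o},\qquad s_\partial=-a\operatorname{div}^\tau(\gamma\nabla^\tau\phi)+\omega\,\partial_N\phi\ \text{ on }\partial\Omega,$$ meaning that $(\nabla\phi,a\nabla^\tau\phi)$ represents $s$, has a solution $\phi$ in the energy space. The solution is unique up to additive constants: for a solution $\phi$, a function $\psi$ is a solution if and only if $\psi=\phi+c$ $(\lambda+\sigma)$-a.e. for some $c\in\mathbb R$. For every solution $\phi$, $$\min\{\|V\|_\rho^2 : V \text{ represents } s\}=\|\phi\|_\rho^2,$$ the minimum being attained. -/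

import Mathlib

open Set Filter Topology MeasureTheory
open scoped ENNReal Gradient

namespace Wentzell

noncomputable section

/-- `Ω ⊆ ℝᵈ` is compact and connected with nonempty interior and smooth connected boundary: near
each boundary point, `Ω` is the sublevel set `{r ≤ 0}` of a smooth function `r` that is regular at
that point. -/
structure IsSmoothDomain {d : ℕ} (Ω : Set (EuclideanSpace ℝ (Fin d))) : Prop where
  isCompact : IsCompact Ω
  isConnected : IsConnected Ω
  nonempty_interior : (interior Ω).Nonempty
  isConnected_boundary : IsConnected (frontier Ω)
  smooth_boundary : ∀ p ∈ frontier Ω, ∃ r : EuclideanSpace ℝ (Fin d) → ℝ,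
    ContDiff ℝ (⊤ : ℕ∞) r ∧ fderiv ℝ r p ≠ 0 ∧ ∀ᶠ x in 𝓝 p, x ∈ Ω ↔ r x ≤ 0

/-- Lebesgue measure `λ` on the interior of `Ω`. -/
def bulk {d : ℕ} (Ω : Set (EuclideanSpace ℝ (Fin d))) : Measure (EuclideanSpace ℝ (Fin d)) :=
  volume.restrict (interior Ω)

/-- The surface measure `σ`: the `(d-1)`-dimensional Hausdorff measure (normalized so as to agree
with Lebesgue measure on Euclidean spaces) on the boundary of `Ω`. -/
def surface {d : ℕ} (Ω : Set (EuclideanSpace ℝ (Fin d))) : Measure (EuclideanSpace ℝ (Fin d)) :=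
  (μHE[d - 1] : Measure (EuclideanSpace ℝ (Fin d))).restrict (frontier Ω)

/-- The pair of densities `(ω, γ)` of a finite measure `ρ = ω λ + γ σ` on `Ω`. Both are positive
almost everywhere and nondegenerate in the sense that `1/ω` and `1/γ` are integrable; this holds
in particular if they are bounded below by positive constants. -/
structure IsDensityPair {d : ℕ} (Ω : Set (EuclideanSpace ℝ (Fin d)))
    (ω γ : EuclideanSpace ℝ (Fin d) → ℝ) : Prop where
  integrable_interior : Integrable ω (bulk Ω)
  integrable_boundary : Integrable γ (surface Ω)
  pos_interior : ∀ᵐ x ∂(bulk Ω), 0 < ω x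
  pos_boundary : ∀ᵐ x ∂(surface Ω), 0 < γ x
  integrable_inv_interior : Integrable (fun x => (ω x)⁻¹) (bulk Ω)
  integrable_inv_boundary : Integrable (fun x => (γ x)⁻¹) (surface Ω)

/-- The measure `ω λ` on the interior of `Ω`. -/
def bulkMass {d : ℕ} (Ω : Set (EuclideanSpace ℝ (Fin d)))
    (ω : EuclideanSpace ℝ (Fin d) → ℝ) : Measure (EuclideanSpace ℝ (Fin d)) :=
  (bulk Ω).withDensity fun x => ENNReal.ofReal (ω x)

/-- The measure `γ σ` on the boundary of `Ω`. -/
def surfaceMass {d : ℕ} (Ω : Set (EuclideanSpace ℝ (Fin d)))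
    (γ : EuclideanSpace ℝ (Fin d) → ℝ) : Measure (EuclideanSpace ℝ (Fin d)) :=
  (surface Ω).withDensity fun x => ENNReal.ofReal (γ x)

/-- The tangent space `T_p ∂Ω`: the vectors annihilated by the differentials at `p` of all smooth
functions that vanish on `∂Ω`. -/
def boundaryTangent {d : ℕ} (Ω : Set (EuclideanSpace ℝ (Fin d)))
    (p : EuclideanSpace ℝ (Fin d)) : Submodule ℝ (EuclideanSpace ℝ (Fin d)) where
  carrier := {v | ∀ f : EuclideanSpace ℝ (Fin d) → ℝ, ContDiff ℝ (⊤ : ℕ∞) f →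
    (∀ x ∈ frontier Ω, f x = 0) → fderiv ℝ f p v = 0}
  zero_mem' := by
    intro f _ _
    simp
  add_mem' := by
    intro v w hv hw f hf h0
    rw [map_add, hv f hf h0, hw f hf h0, add_zero]
  smul_mem' := by
    intro c v hv f hf h0
    rw [map_smul, hv f hf h0, smul_zero]

/-- The tangential gradient `∇^τ ξ` of a smooth function: the orthogonal projection of its gradient
to the tangent space of the boundary. -/
def tangentialGradient {d : ℕ} (Ω : Set (EuclideanSpace ℝ (Fin d)))
    (ξ : EuclideanSpace ℝ (Fin d) → ℝ) (p : EuclideanSpace ℝ (Fin d)) :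
    EuclideanSpace ℝ (Fin d) :=
  (boundaryTangent Ω p).starProjection (∇ ξ p)

/-- Smooth functions on a subset `K` of `ℝᵈ`: the restrictions to `K` of smooth functions
on `ℝᵈ`. -/
def smoothFunctions {d : ℕ} (K : Set (EuclideanSpace ℝ (Fin d))) : Submodule ℝ (K → ℝ) where
  carrier := {u | ∃ ξ : EuclideanSpace ℝ (Fin d) → ℝ, ContDiff ℝ (⊤ : ℕ∞) ξ ∧ K.domRestrict ξ = u}
  zero_mem' := ⟨fun _ => 0, contDiff_const, rfl⟩
  add_mem' := by
    rintro _ _ ⟨ξ, hξ, rfl⟩ ⟨η, hη, rfl⟩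
    exact ⟨fun x => ξ x + η x, hξ.add hη, rfl⟩
  smul_mem' := by
    rintro c _ ⟨ξ, hξ, rfl⟩
    exact ⟨fun x => c * ξ x, contDiff_const.mul hξ, rfl⟩

/-- The restriction of a smooth function on `ℝᵈ` to `K`. -/
def restrictTo {d : ℕ} (K : Set (EuclideanSpace ℝ (Fin d)))
    (ξ : EuclideanSpace ℝ (Fin d) → ℝ) (hξ : ContDiff ℝ (⊤ : ℕ∞) ξ) : smoothFunctions K :=
  ⟨K.domRestrict ξ, ξ, hξ, rfl⟩

/-- A perturbation `s = (s_o, s_∂)`: an interior part acting linearly on smooth functions on `Ω`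
and a boundary part acting linearly on smooth functions on `∂Ω`. A pair of finite signed measures
on the interior and on the boundary acts in this way by integration. -/
structure Perturbation {d : ℕ} (Ω : Set (EuclideanSpace ℝ (Fin d))) where
  interior : smoothFunctions Ω →ₗ[ℝ] ℝ
  boundary : smoothFunctions (frontier Ω) →ₗ[ℝ] ℝ

/-- An interior/boundary pair of vector fields; `inner` matters only on the interior and `bdry`
only on the boundary of the domain. -/
structure VelocityPair (d : ℕ) where
  inner : EuclideanSpace ℝ (Fin d) → EuclideanSpace ℝ (Fin d)
  bdry : EuclideanSpace ℝ (Fin d) → EuclideanSpace ℝ (Fin d)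

/-- `∫_{Ω°} ω V_o · ∇ξ`, which is `⟨-div (ω V_o), ξ⟩` if `ξ` has compact support in the
interior. -/
def bulkPairing {d : ℕ} (Ω : Set (EuclideanSpace ℝ (Fin d)))
    (ω : EuclideanSpace ℝ (Fin d) → ℝ) (V : VelocityPair d)
    (ξ : EuclideanSpace ℝ (Fin d) → ℝ) : ℝ :=
  ∫ x, inner ℝ (V.inner x) (∇ ξ x) ∂(bulkMass Ω ω)

/-- `⟨-div^τ (γ V_∂), ξ⟩ = ∫_{∂Ω} γ V_∂ · ∇^τ ξ`. -/
def surfacePairing {d : ℕ} (Ω : Set (EuclideanSpace ℝ (Fin d)))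
    (γ : EuclideanSpace ℝ (Fin d) → ℝ) (V : VelocityPair d)
    (ξ : EuclideanSpace ℝ (Fin d) → ℝ) : ℝ :=
  ∫ x, inner ℝ (V.bdry x) (tangentialGradient Ω ξ x) ∂(surfaceMass Ω γ)

/-- `V` represents `s`, in the weak sense: `V_∂` is tangent to `∂Ω`, and
* `s_o = -div (ω V_o)` in `Ω°`,
* `s_∂ = -div^τ (γ V_∂) + ω V_o · N` on `∂Ω`.
Here the weak outer normal flux `ω V_o · N` of the field `ω V_o`, whose divergence is `-s_o`, is
given by Green's formula `⟨ω V_o · N, ξ⟩ = ∫_{Ω°} ω V_o · ∇ξ - ⟨s_o, ξ⟩`. The second equation says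
that `⟨s_o, ξ⟩ + ⟨s_∂, ξ⟩ = ∫_{Ω°} ω V_o · ∇ξ + ∫_{∂Ω} γ V_∂ · ∇^τ ξ`. -/
structure Represents {d : ℕ} (Ω : Set (EuclideanSpace ℝ (Fin d)))
    (ω γ : EuclideanSpace ℝ (Fin d) → ℝ) (s : Perturbation Ω) (V : VelocityPair d) : Prop where
  integrable_inner : Integrable V.inner (bulkMass Ω ω)
  integrable_bdry : Integrable V.bdry (surfaceMass Ω γ)
  tangent : ∀ᵐ x ∂(surface Ω), V.bdry x ∈ boundaryTangent Ω x
  interior_eq : ∀ (ξ : EuclideanSpace ℝ (Fin d) → ℝ) (hξ : ContDiff ℝ (⊤ : ℕ∞) ξ),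
    HasCompactSupport ξ → tsupport ξ ⊆ interior Ω →
      s.interior (restrictTo Ω ξ hξ) = bulkPairing Ω ω V ξ
  boundary_eq : ∀ (ξ : EuclideanSpace ℝ (Fin d) → ℝ) (hξ : ContDiff ℝ (⊤ : ℕ∞) ξ),
    s.boundary (restrictTo (frontier Ω) ξ hξ)
      = surfacePairing Ω γ V ξ + (bulkPairing Ω ω V ξ - s.interior (restrictTo Ω ξ hξ))

/-- The kinetic energy `‖V‖²_ρ = ∫_{Ω°} |V_o|² ω + (1/a) ∫_{∂Ω} |V_∂|² γ`, possibly infinite. -/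
def kineticEnergy {d : ℕ} (Ω : Set (EuclideanSpace ℝ (Fin d)))
    (ω γ : EuclideanSpace ℝ (Fin d) → ℝ) (a : ℝ) (V : VelocityPair d) : ℝ≥0∞ :=
  (∫⁻ x, ‖V.inner x‖ₑ ^ 2 ∂(bulkMass Ω ω))
    + ENNReal.ofReal (1 / a) * ∫⁻ x, ‖V.bdry x‖ₑ ^ 2 ∂(surfaceMass Ω γ)

/-- `φ` lies in the energy space, with gradients `G = (∇φ, ∇^τ φ)`: the function `φ` on
`Ω = Ω° ∪ ∂Ω` is a limit of smooth functions `ξ n`, where `ξ n → φ` in `L¹` on `Ω°` and on `∂Ω`,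
`∇ ξ n → ∇φ` in `L²(ω)` and `∇^τ ξ n → ∇^τ φ` in `L²(γ)`. Thus `φ` on `∂Ω` is the trace of `φ`
on `Ω°`. As `1/ω` and `1/γ` are integrable, `∇φ` and `∇^τ φ` are the weak gradients of `φ` on `Ω°`
and on `∂Ω`, and are determined by `φ`. -/
structure HasEnergyGradient {d : ℕ} (Ω : Set (EuclideanSpace ℝ (Fin d)))
    (ω γ : EuclideanSpace ℝ (Fin d) → ℝ) (φ : EuclideanSpace ℝ (Fin d) → ℝ)
    (G : VelocityPair d) : Prop where
  memLp_interior : MemLp φ 1 (bulk Ω)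
  memLp_boundary : MemLp φ 1 (surface Ω)
  memLp_gradient : MemLp G.inner 2 (bulkMass Ω ω)
  memLp_tangentialGradient : MemLp G.bdry 2 (surfaceMass Ω γ)
  approx : ∃ ξ : ℕ → EuclideanSpace ℝ (Fin d) → ℝ, (∀ n, ContDiff ℝ (⊤ : ℕ∞) (ξ n)) ∧
    Tendsto (fun n => eLpNorm (fun x => ξ n x - φ x) 1 (bulk Ω)) atTop (𝓝 0) ∧
    Tendsto (fun n => eLpNorm (fun x => ξ n x - φ x) 1 (surface Ω)) atTop (𝓝 0) ∧
    Tendsto (fun n => eLpNorm (fun x => ∇ (ξ n) x - G.inner x) 2 (bulkMass Ω ω))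
      atTop (𝓝 0) ∧
    Tendsto (fun n => eLpNorm (fun x => tangentialGradient Ω (ξ n) x - G.bdry x) 2
      (surfaceMass Ω γ)) atTop (𝓝 0)

/-- `‖φ‖²_ρ = ∫_{Ω°} |∇φ|² ω + a ∫_{∂Ω} |∇^τ φ|² γ`, in terms of the gradients
`G = (∇φ, ∇^τ φ)`. -/
def potentialEnergy {d : ℕ} (Ω : Set (EuclideanSpace ℝ (Fin d)))
    (ω γ : EuclideanSpace ℝ (Fin d) → ℝ) (a : ℝ) (G : VelocityPair d) : ℝ≥0∞ :=
  (∫⁻ x, ‖G.inner x‖ₑ ^ 2 ∂(bulkMass Ω ω))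
    + ENNReal.ofReal a * ∫⁻ x, ‖G.bdry x‖ₑ ^ 2 ∂(surfaceMass Ω γ)

/-- `φ`, with gradients `G = (∇φ, ∇^τ φ)`, is a weak solution of
* `s_o = -div (ω ∇φ)` in `Ω°`,
* `s_∂ = -a div^τ (γ ∇^τ φ) + ω ∂_N φ` on `∂Ω`. -/
def IsEllipticSolution {d : ℕ} (Ω : Set (EuclideanSpace ℝ (Fin d)))
    (ω γ : EuclideanSpace ℝ (Fin d) → ℝ) (a : ℝ) (s : Perturbation Ω)
    (φ : EuclideanSpace ℝ (Fin d) → ℝ) (G : VelocityPair d) : Prop :=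
  HasEnergyGradient Ω ω γ φ G ∧ Represents Ω ω γ s ⟨G.inner, fun x => a • G.bdry x⟩

end

end Wentzell

/-! Writing `V = (G_o, a G_∂)` turns the kinetic energy of `V` into the squared norm of `G` in the
Hilbert space `FieldSpace`, and turns the weak equations into the condition that the inner product
of `G` with the gradient pair of every smooth `ξ` is the action of `s` on `ξ`
(`bulkPairing_add_surfacePairing`). Hence any two representing fields of finite energy differ by an
element orthogonal to `gradients`. Projecting one of them onto the closure of `gradients` keeps
these inner products, so it gives the representing field in that closure, and by Pythagoras the one
of least norm.

The analysis lies in showing that each element of the closure is the gradient pair of some function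
in the energy space, and that this function is determined up to one constant. Both follow from
`exists_poincare_energy`: the distance in L¹(λ+σ) of `ξ` from its interior mean is bounded by the
norm of `∇ ξ` in L²(ωλ). As `1/ω` is integrable, Cauchy–Schwarz reduces this to the unweighted L¹
inequality `IsSmoothDomain.exists_poincare`, which combines an interior Poincaré inequality
(`IsSmoothDomain.linked_interior`) with a trace inequality
(`IsSmoothDomain.exists_lintegral_surface_le`). The former chains local oscillation bounds through
`Ω` by connectedness and compactness; the latter integrates along a direction transversal to the
boundary, which is locally a Lipschitz graph. Since the interior gradient controls the trace as
well, the constant is the same in the interior and on the boundary. -/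

namespace Wentzell

/-! ### The L¹ Poincaré inequality by chaining local oscillation bounds -/

section Poincare

variable {E : Type*} [NormedAddCommGroup E] [NormedSpace ℝ E]

theorem enorm_sub_le_lintegral_fderiv {ξ : E → ℝ} (hξ : ContDiff ℝ 1 ξ) (x h : E) {T : ℝ}
    (hT : 0 ≤ T) :
    ‖ξ (x + T • h) - ξ x‖ₑ ≤ ‖h‖ₑ * ∫⁻ t in Ioc (0 : ℝ) T, ‖fderiv ℝ ξ (x + t • h)‖ₑ := by
  have hcont : Continuous fun t : ℝ => fderiv ℝ ξ (x + t • h) :=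
    (hξ.continuous_fderiv one_ne_zero).comp (by fun_prop)
  have hderiv : ∀ t ∈ uIcc (0 : ℝ) T,
      HasDerivAt (fun t : ℝ => ξ (x + t • h)) (fderiv ℝ ξ (x + t • h) h) t := by
    intro t _
    have h1 : HasDerivAt (fun t : ℝ => x + t • h) h t := by
      simpa using ((hasDerivAt_id t).smul_const h).const_add x
    exact ((hξ.differentiable one_ne_zero _).hasFDerivAt).comp_hasDerivAt t h1
  have hint : IntervalIntegrable (fun t : ℝ => fderiv ℝ ξ (x + t • h) h) volume 0 T :=
    (hcont.clm_apply continuous_const).intervalIntegrable _ _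
  have key := intervalIntegral.integral_eq_sub_of_hasDerivAt hderiv hint
  simp only [zero_smul, add_zero] at key
  rw [← key, intervalIntegral.integral_of_le hT, ← lintegral_const_mul _ hcont.enorm.measurable]
  refine (enorm_integral_le_lintegral_enorm _).trans (lintegral_mono fun t => ?_)
  rw [mul_comm]
  exact ContinuousLinearMap.le_opENorm _ _

variable [MeasurableSpace E]

/-- The mean oscillation between `A` and `B` of any `C¹` function is controlled by the total
variation of the function on `U`. -/
def Linked (μ : Measure E) (U A B : Set E) : Prop :=
  ∃ C : ℝ≥0∞, C ≠ ∞ ∧ ∀ ξ : E → ℝ, ContDiff ℝ 1 ξ →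
    ∫⁻ x in A, ∫⁻ y in B, ‖ξ x - ξ y‖ₑ ∂μ ∂μ ≤ C * ∫⁻ x in U, ‖fderiv ℝ ξ x‖ₑ ∂μ

variable {μ : Measure E} {U A B D : Set E}

theorem Linked.mono {A' B' : Set E} (h : Linked μ U A B) (hA : A' ⊆ A) (hB : B' ⊆ B) :
    Linked μ U A' B' := by
  obtain ⟨C, hC, h⟩ := h
  refine ⟨C, hC, fun ξ hξ => le_trans ?_ (h ξ hξ)⟩
  exact lintegral_mono' (Measure.restrict_mono hA le_rfl) fun x =>
    lintegral_mono' (Measure.restrict_mono hB le_rfl) le_rfl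

theorem Linked.union_left {A' : Set E} (h : Linked μ U A B) (h' : Linked μ U A' B) :
    Linked μ U (A ∪ A') B := by
  obtain ⟨C, hC, h⟩ := h
  obtain ⟨C', hC', h'⟩ := h'
  refine ⟨C + C', by finiteness, fun ξ hξ => (lintegral_union_le _ _ _).trans ?_⟩
  rw [add_mul]
  exact add_le_add (h ξ hξ) (h' ξ hξ)

theorem linked_empty_left : Linked μ U ∅ B := ⟨0, by simp, fun ξ _ => by simp⟩

variable [BorelSpace E] [FiniteDimensional ℝ E] [μ.IsAddHaarMeasure]

/-- The fundamental theorem of calculus along the segment from `x` to `x + h`, then Tonelli: for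
each fixed `t`, the translate of `A` by `t • h` lies in `U`, and `μ` is translation invariant. -/
theorem setLIntegral_enorm_sub_translate_le {ξ : E → ℝ} (hξ : ContDiff ℝ 1 ξ) {U A : Set E}
    (hU : MeasurableSet U) (hA : MeasurableSet A) (h : E)
    (hAU : ∀ x ∈ A, ∀ t ∈ Ioc (0 : ℝ) 1, x + t • h ∈ U) :
    ∫⁻ x in A, ‖ξ (x + h) - ξ x‖ₑ ∂μ ≤ ‖h‖ₑ * ∫⁻ x in U, ‖fderiv ℝ ξ x‖ₑ ∂μ := by
  have hcont : Continuous fun x => ‖fderiv ℝ ξ x‖ₑ :=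
    (hξ.continuous_fderiv one_ne_zero).enorm
  have hmeas : Measurable (Function.uncurry fun (x : E) (t : ℝ) => ‖fderiv ℝ ξ (x + t • h)‖ₑ) :=
    (hcont.comp (by fun_prop : Continuous fun p : E × ℝ => p.1 + p.2 • h)).measurable
  calc ∫⁻ x in A, ‖ξ (x + h) - ξ x‖ₑ ∂μ
      ≤ ∫⁻ x in A, ‖h‖ₑ * (∫⁻ t in Ioc (0 : ℝ) 1, ‖fderiv ℝ ξ (x + t • h)‖ₑ) ∂μ :=
        lintegral_mono fun x => by
          simpa using enorm_sub_le_lintegral_fderiv hξ x h zero_le_one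
    _ = ‖h‖ₑ * ∫⁻ x in A, (∫⁻ t in Ioc (0 : ℝ) 1, ‖fderiv ℝ ξ (x + t • h)‖ₑ) ∂μ :=
        lintegral_const_mul _ hmeas.lintegral_prod_right'
    _ = ‖h‖ₑ * ∫⁻ t in Ioc (0 : ℝ) 1, (∫⁻ x in A, ‖fderiv ℝ ξ (x + t • h)‖ₑ ∂μ) := by
        rw [lintegral_lintegral_swap hmeas.aemeasurable]
    _ ≤ ‖h‖ₑ * ∫⁻ _t in Ioc (0 : ℝ) 1, (∫⁻ x in U, ‖fderiv ℝ ξ x‖ₑ ∂μ) := by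
        refine mul_le_mul_right ?_ _
        refine setLIntegral_mono measurable_const fun t ht => ?_
        rw [← lintegral_indicator hU, ← lintegral_add_right_eq_self (μ := μ) _ (t • h),
          ← lintegral_indicator hA]
        refine lintegral_mono fun x => ?_
        by_cases hx : x ∈ A
        · simp [hx, hAU x hx t ht]
        · simp [hx]
    _ = ‖h‖ₑ * ∫⁻ x in U, ‖fderiv ℝ ξ x‖ₑ ∂μ := by simp

theorem measurable_enorm_sub {ξ : E → ℝ} (hξ : Continuous ξ) :
    Measurable (Function.uncurry fun x y : E => ‖ξ x - ξ y‖ₑ) :=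
  Continuous.measurable (by unfold Function.uncurry; fun_prop)

theorem Linked.symm (h : Linked μ U A B) : Linked μ U B A := by
  obtain ⟨C, hC, h⟩ := h
  refine ⟨C, hC, fun ξ hξ => le_trans (le_of_eq ?_) (h ξ hξ)⟩
  rw [lintegral_lintegral_swap (measurable_enorm_sub hξ.continuous).aemeasurable]
  simp only [enorm_sub_rev]

/-- The triangle inequality through a point `y`, averaged over `y ∈ B`. The average makes sense
because `μ B` is neither zero nor infinite. -/
theorem Linked.trans (h : Linked μ U A B) (h' : Linked μ U B D) (hB : μ B ≠ 0)
    (hB' : μ B ≠ ∞) (hA : μ A ≠ ∞) (hD : μ D ≠ ∞) : Linked μ U A D := by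
  obtain ⟨C, hC, h⟩ := h
  obtain ⟨C', hC', h'⟩ := h'.symm
  refine ⟨(μ B)⁻¹ * (μ D * C + μ A * C'), by finiteness, fun ξ hξ => ?_⟩
  have hm := measurable_enorm_sub hξ.continuous
  have hm1 : ∀ x, Measurable fun y => ‖ξ x - ξ y‖ₑ := fun x => hm.of_uncurry_left
  have hpt : ∀ x z, μ B * ‖ξ x - ξ z‖ₑ
      ≤ (∫⁻ y in B, ‖ξ x - ξ y‖ₑ ∂μ) + ∫⁻ y in B, ‖ξ z - ξ y‖ₑ ∂μ := by
    intro x z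
    rw [← lintegral_add_left (hm1 x), mul_comm, ← setLIntegral_const]
    refine lintegral_mono fun y => ?_
    have : ξ x - ξ z = (ξ x - ξ y) + (ξ y - ξ z) := by ring
    rw [this, enorm_sub_rev (ξ z)]
    exact enorm_add_le _ _
  have hmB : Measurable fun x => ∫⁻ y in B, ‖ξ x - ξ y‖ₑ ∂μ := hm.lintegral_prod_right'
  have hmul : μ B * ∫⁻ x in A, ∫⁻ z in D, ‖ξ x - ξ z‖ₑ ∂μ ∂μ
      ≤ (μ D * C + μ A * C') * ∫⁻ x in U, ‖fderiv ℝ ξ x‖ₑ ∂μ := by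
    calc μ B * ∫⁻ x in A, ∫⁻ z in D, ‖ξ x - ξ z‖ₑ ∂μ ∂μ
        = ∫⁻ x in A, ∫⁻ z in D, μ B * ‖ξ x - ξ z‖ₑ ∂μ ∂μ := by
          rw [← lintegral_const_mul _ (by exact hm.lintegral_prod_right')]
          simp_rw [lintegral_const_mul _ (hm1 _)]
      _ ≤ ∫⁻ x in A, ∫⁻ z in D, ((∫⁻ y in B, ‖ξ x - ξ y‖ₑ ∂μ)
            + ∫⁻ y in B, ‖ξ z - ξ y‖ₑ ∂μ) ∂μ ∂μ :=
          lintegral_mono fun x => lintegral_mono fun z => hpt x z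
      _ = μ D * (∫⁻ x in A, ∫⁻ y in B, ‖ξ x - ξ y‖ₑ ∂μ ∂μ)
            + μ A * ∫⁻ z in D, ∫⁻ y in B, ‖ξ z - ξ y‖ₑ ∂μ ∂μ := by
          simp_rw [lintegral_add_left measurable_const, setLIntegral_const]
          rw [lintegral_add_right _ measurable_const, setLIntegral_const,
            lintegral_mul_const _ hmB, mul_comm (μ D), mul_comm (μ A)]
      _ ≤ μ D * (C * ∫⁻ x in U, ‖fderiv ℝ ξ x‖ₑ ∂μ)
            + μ A * (C' * ∫⁻ x in U, ‖fderiv ℝ ξ x‖ₑ ∂μ) := by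
          gcongr
          · exact h ξ hξ
          · exact h' ξ hξ
      _ = _ := by ring
  calc ∫⁻ x in A, ∫⁻ z in D, ‖ξ x - ξ z‖ₑ ∂μ ∂μ
      = (μ B)⁻¹ * (μ B * ∫⁻ x in A, ∫⁻ z in D, ‖ξ x - ξ z‖ₑ ∂μ ∂μ) := by
        rw [← mul_assoc, ENNReal.inv_mul_cancel hB hB', one_mul]
    _ ≤ _ := by
        rw [mul_assoc]
        gcongr

/-- Substituting `y = x + h`, convexity keeps the segment from `x` to `y` inside `A`, so each
displacement `h` costs at most `‖h‖` times the total variation. Boundedness leaves only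
displacements in a ball of radius `2 * R`. -/
theorem linked_self_of_convex (hU : MeasurableSet U) (hA : MeasurableSet A) (hAU : A ⊆ U)
    (hconv : Convex ℝ A) (hbdd : Bornology.IsBounded A) : Linked μ U A A := by
  obtain ⟨R, hR⟩ := hbdd.subset_closedBall 0
  refine ⟨μ (Metric.closedBall 0 (2 * R)) * ENNReal.ofReal (2 * R), ?_, fun ξ hξ => ?_⟩
  · exact ENNReal.mul_ne_top measure_closedBall_lt_top.ne ENNReal.ofReal_ne_top
  have hshift : ∀ h : E, MeasurableSet ((fun x => x + h) ⁻¹' A) := fun h =>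
    hA.preimage (by fun_prop)
  have hm : Measurable (Function.uncurry fun (x h : E) =>
      A.indicator (fun y => ‖ξ y - ξ x‖ₑ) (x + h)) := by
    have : (Function.uncurry fun (x h : E) => A.indicator (fun y => ‖ξ y - ξ x‖ₑ) (x + h))
        = ((fun p : E × E => p.1 + p.2) ⁻¹' A).indicator
          (fun p => ‖ξ (p.1 + p.2) - ξ p.1‖ₑ) := by
      rfl
    rw [this]
    refine Measurable.indicator ?_ (hA.preimage (by fun_prop))
    have := hξ.continuous
    exact Continuous.measurable (by fun_prop)
  calc ∫⁻ x in A, ∫⁻ y in A, ‖ξ x - ξ y‖ₑ ∂μ ∂μ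
      = ∫⁻ x in A, ∫⁻ h, A.indicator (fun y => ‖ξ y - ξ x‖ₑ) (x + h) ∂μ ∂μ := by
        refine lintegral_congr fun x => ?_
        rw [lintegral_add_left_eq_self (μ := μ) (A.indicator fun y => ‖ξ y - ξ x‖ₑ) x,
          lintegral_indicator hA]
        simp only [enorm_sub_rev]
    _ = ∫⁻ h, ∫⁻ x in A, A.indicator (fun y => ‖ξ y - ξ x‖ₑ) (x + h) ∂μ ∂μ :=
        lintegral_lintegral_swap hm.aemeasurable
    _ ≤ ∫⁻ h, (Metric.closedBall (0 : E) (2 * R)).indicator (fun _ =>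
          ENNReal.ofReal (2 * R) * ∫⁻ x in U, ‖fderiv ℝ ξ x‖ₑ ∂μ) h ∂μ := by
        refine lintegral_mono fun h => ?_
        by_cases hh : h ∈ Metric.closedBall (0 : E) (2 * R)
        · rw [indicator_of_mem hh]
          have h1 : ∫⁻ x in A, A.indicator (fun y => ‖ξ y - ξ x‖ₑ) (x + h) ∂μ
              = ∫⁻ x in A ∩ (fun x => x + h) ⁻¹' A, ‖ξ (x + h) - ξ x‖ₑ ∂μ := by
            rw [inter_comm, ← Measure.restrict_restrict (hshift h),
              ← lintegral_indicator (hshift h)]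
            rfl
          rw [h1]
          refine (setLIntegral_enorm_sub_translate_le hξ hU (hA.inter (hshift h)) h ?_).trans ?_
          · rintro x ⟨hx, hxh⟩ t ht
            apply hAU
            have := hconv.add_smul_mem hx hxh (t := t) ⟨ht.1.le, ht.2⟩
            exact this
          · gcongr
            rw [← ofReal_norm]
            exact ENNReal.ofReal_le_ofReal (by simpa using hh)
        · rw [indicator_of_notMem hh]
          refine le_of_eq (setLIntegral_eq_zero hA fun x hx => indicator_of_notMem (fun hxh => hh ?_) _)
          have h1 := hR hx
          have h2 := hR hxh
          simp only [Metric.mem_closedBall, dist_zero_right] at *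
          calc ‖h‖ = ‖(x + h) - x‖ := by simp
            _ ≤ ‖x + h‖ + ‖x‖ := norm_sub_le _ _
            _ ≤ 2 * R := by linarith
    _ = _ := by
        rw [lintegral_indicator measurableSet_closedBall, setLIntegral_const]
        ring

/-- If `A` can be translated into a convex subset of `U` without leaving `U`, then `A` is linked
to itself. -/
theorem linked_self_of_translate (hU : MeasurableSet U) (hA : MeasurableSet A)
    (hD : MeasurableSet D) (hDU : D ⊆ U) (hconv : Convex ℝ D) (hbdd : Bornology.IsBounded D)
    (hD0 : μ D ≠ 0) (hA' : μ A ≠ ∞) (h : E)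
    (hAU : ∀ x ∈ A, ∀ t ∈ Ioc (0 : ℝ) 1, x + t • h ∈ U) (hAD : ∀ x ∈ A, x + h ∈ D) :
    Linked μ U A A := by
  have hD' : μ D ≠ ∞ := hbdd.measure_lt_top.ne
  obtain ⟨C, hC, hDD⟩ := linked_self_of_convex (μ := μ) hU hD hDU hconv hbdd
  -- The value at `x ∈ A` is compared with the value at `x + h ∈ D`, and `D` is linked to itself by
  -- convexity. Then `A` is linked to `A` through `D`.
  have key : Linked μ U A D := by
    refine ⟨μ D * ‖h‖ₑ + C, by finiteness, fun ξ hξ => ?_⟩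
    have hm := measurable_enorm_sub hξ.continuous
    have hc := hξ.continuous
    have hm0 : Measurable fun x => ‖ξ (x + h) - ξ x‖ₑ := Continuous.measurable (by fun_prop)
    have hmD : Measurable fun x => ∫⁻ y in D, ‖ξ x - ξ y‖ₑ ∂μ := hm.lintegral_prod_right'
    calc ∫⁻ x in A, ∫⁻ y in D, ‖ξ x - ξ y‖ₑ ∂μ ∂μ
        ≤ ∫⁻ x in A, ∫⁻ y in D, (‖ξ (x + h) - ξ x‖ₑ + ‖ξ (x + h) - ξ y‖ₑ) ∂μ ∂μ := by
          refine lintegral_mono fun x => lintegral_mono fun y => ?_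
          have : ξ x - ξ y = (ξ x - ξ (x + h)) + (ξ (x + h) - ξ y) := by ring
          rw [this, enorm_sub_rev (ξ (x + h)) (ξ x)]
          exact enorm_add_le _ _
      _ = (∫⁻ x in A, ‖ξ (x + h) - ξ x‖ₑ ∂μ) * μ D
            + ∫⁻ x in A, ∫⁻ y in D, ‖ξ (x + h) - ξ y‖ₑ ∂μ ∂μ := by
          simp_rw [lintegral_add_left measurable_const, setLIntegral_const]
          rw [lintegral_add_left (hm0.mul_const _), lintegral_mul_const _ hm0]
      _ ≤ (‖h‖ₑ * ∫⁻ x in U, ‖fderiv ℝ ξ x‖ₑ ∂μ) * μ D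
            + C * ∫⁻ x in U, ‖fderiv ℝ ξ x‖ₑ ∂μ := by
          gcongr
          · exact setLIntegral_enorm_sub_translate_le hξ hU hA h hAU
          · refine le_trans ?_ (hDD ξ hξ)
            rw [← lintegral_indicator hD, ← lintegral_add_right_eq_self (μ := μ) _ h,
              ← lintegral_indicator hA]
            refine lintegral_mono fun x => ?_
            by_cases hx : x ∈ A
            · simp [hx, hAD x hx]
            · simp [hx]
      _ = _ := by ring
  exact key.trans key.symm hD0 hD' hA' hA'

/-- Being linked near `p` and `q` is a symmetric, transitive and locally reflexive relation, so
preconnectedness of `K` extends it to all pairs. Transitivity needs an overlap of positive measure,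
which is where `K ⊆ closure U` enters. Compactness is then used twice, once in each variable, to
pass from neighbourhoods to all of `U`. -/
theorem linked_self_of_locally {K : Set E} (hK : IsCompact K) (hKconn : IsPreconnected K)
    (hU : IsOpen U) (hUK : U ⊆ K) (hKU : K ⊆ closure U)
    (hloc : ∀ p ∈ K, ∃ W ∈ 𝓝 p, Linked μ U (W ∩ U) (W ∩ U)) : Linked μ U U U := by
  have hUfin : μ U ≠ ∞ := ((measure_mono hUK).trans_lt hK.measure_lt_top).ne
  have hfin : ∀ W : Set E, μ (W ∩ U) ≠ ∞ := fun W =>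
    ((measure_mono inter_subset_right).trans_lt hUfin.lt_top).ne
  have hpair : ∀ p ∈ K, ∀ q ∈ K, ∃ W ∈ 𝓝 p, ∃ W' ∈ 𝓝 q, Linked μ U (W ∩ U) (W' ∩ U) := by
    intro p hp q hq
    refine hKconn.induction₂
      (fun p q => ∃ W ∈ 𝓝 p, ∃ W' ∈ 𝓝 q, Linked μ U (W ∩ U) (W' ∩ U)) ?_ ?_ ?_ hp hq
    · intro x hx
      obtain ⟨W, hW, hL⟩ := hloc x hx
      obtain ⟨O, hOW, hO, hxO⟩ := mem_nhds_iff.1 hW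
      refine mem_of_superset (mem_nhdsWithin_of_mem_nhds (hO.mem_nhds hxO)) fun y hy => ?_
      exact ⟨W, hW, W, mem_of_superset (hO.mem_nhds hy) hOW, hL⟩
    · rintro x y z hx hy hz ⟨W, hW, W', hW', hL⟩ ⟨S, hS, S', hS', hL'⟩
      refine ⟨W, hW, S', hS', ?_⟩
      refine (hL.mono (B' := W' ∩ S ∩ U) le_rfl (by gcongr; exact inter_subset_left)).trans
        (hL'.mono (by gcongr; exact inter_subset_right) le_rfl) ?_ (hfin _) (hfin _) (hfin _)
      have hn : W' ∩ S ∈ 𝓝 y := inter_mem hW' hS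
      obtain ⟨O, hOW, hO, hyO⟩ := mem_nhds_iff.1 hn
      obtain ⟨w, hwO, hwU⟩ := mem_closure_iff.1 (hKU hy) O hO hyO
      exact (((hO.inter hU).measure_pos μ ⟨w, hwO, hwU⟩).trans_le
        (measure_mono (inter_subset_inter_left U hOW))).ne'
    · rintro x y hx hy ⟨W, hW, W', hW', hL⟩
      exact ⟨W', hW', W, hW, hL.symm⟩
  have hone : ∀ p ∈ K, ∃ W ∈ 𝓝 p, Linked μ U (W ∩ U) (K ∩ U) := by
    intro p hp
    refine hK.induction_on (p := fun S => ∃ W ∈ 𝓝 p, Linked μ U (W ∩ U) (S ∩ U)) ?_ ?_ ?_ ?_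
    · refine ⟨univ, univ_mem, ?_⟩
      rw [empty_inter]
      exact linked_empty_left.symm
    · rintro S T hST ⟨W, hW, hL⟩
      exact ⟨W, hW, hL.mono le_rfl (by gcongr)⟩
    · rintro S T ⟨W, hW, hL⟩ ⟨W', hW', hL'⟩
      refine ⟨W ∩ W', inter_mem hW hW', ?_⟩
      rw [union_inter_distrib_right]
      exact ((hL.mono (by gcongr; exact inter_subset_left) le_rfl).symm.union_left
        (hL'.mono (by gcongr; exact inter_subset_right) le_rfl).symm).symm
    · intro q hq
      obtain ⟨W, hW, W', hW', hL⟩ := hpair p hp q hq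
      exact ⟨W', mem_nhdsWithin_of_mem_nhds hW', W, hW, hL⟩
  have hall : Linked μ U (K ∩ U) (K ∩ U) := by
    refine hK.induction_on (p := fun S => Linked μ U (S ∩ U) (K ∩ U)) ?_ ?_ ?_ ?_
    · rw [empty_inter]
      exact linked_empty_left
    · exact fun S T hST hL => hL.mono (by gcongr) le_rfl
    · intro S T hL hL'
      rw [union_inter_distrib_right]
      exact hL.union_left hL'
    · intro q hq
      obtain ⟨W, hW, hL⟩ := hone q hq
      exact ⟨W, mem_nhdsWithin_of_mem_nhds hW, hL⟩
  rwa [inter_eq_right.2 hUK] at hall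

end Poincare

/-! ### Transversal directions and the trace inequality over a Lipschitz graph -/

section Transversal

variable {E : Type*} [NormedAddCommGroup E] [NormedSpace ℝ E]

/-- Near `p`, strict differentiability makes increments of `r` close to those of `A`. Hence `r`
decreases along `e` at rate at least `1/2`, and on a level set of `r` the increment `A (x - y)` is
so small that the projection `z + A z • e` along `e` to the kernel of `A` is injective with
Lipschitz inverse. -/
theorem exists_transversal {r : E → ℝ} {A : E →L[ℝ] ℝ} {p : E} (hr : HasStrictFDerivAt r A p)
    (hA : A ≠ 0) : ∃ e : E, A e = -1 ∧ ∃ ε > 0,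
      (∀ x ∈ Metric.ball p ε, ∀ t : ℝ, 0 ≤ t → x + t • e ∈ Metric.ball p ε →
        r (x + t • e) ≤ r x - t / 2) ∧
      ∀ x ∈ Metric.ball p ε, ∀ y ∈ Metric.ball p ε, r x = r y →
        ‖x - y‖ ≤ (1 + ‖e‖) * ‖(x - y) + A (x - y) • e‖ := by
  obtain ⟨v, hv⟩ : ∃ v, A v ≠ 0 := by
    by_contra! h
    exact hA (ContinuousLinearMap.ext h)
  set e : E := -(A v)⁻¹ • v with he
  have hAe : A e = -1 := by simp [he, hv]
  -- With `c = 1 / (2 * (‖e‖ + 1))`, the bound `c * ‖e‖ ≤ 1 / 2` preserves half of the decrease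
  -- along `e`; together with `c ≤ 1 / 2` it lets `|A z|` be absorbed in the Lipschitz estimate.
  have hc : (0 : ℝ) < 1 / (2 * (‖e‖ + 1)) := by positivity
  have hce : 1 / (2 * (‖e‖ + 1)) * ‖e‖ ≤ 1 / 2 := by
    rw [div_mul_eq_mul_div, div_le_div_iff₀ (by positivity) (by positivity)]
    linarith [norm_nonneg e]
  have hc1 : 1 / (2 * (‖e‖ + 1)) ≤ 1 / 2 := by
    rw [div_le_div_iff₀ (by positivity) (by positivity)]
    linarith [norm_nonneg e]
  obtain ⟨ε, hε, hball⟩ := Metric.eventually_nhds_iff_ball.1 (hr.isLittleO.def hc)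
  have hball' : ∀ x ∈ Metric.ball p ε, ∀ y ∈ Metric.ball p ε,
      |r x - r y - A (x - y)| ≤ 1 / (2 * (‖e‖ + 1)) * ‖x - y‖ := fun x hx y hy =>
    hball (x, y) (by rw [← ball_prod_same]; exact ⟨hx, hy⟩)
  refine ⟨e, hAe, ε, hε, fun x hx t ht hxt => ?_, fun x hx y hy hxy => ?_⟩
  · have h := hball' _ hxt x hx
    rw [add_sub_cancel_left, map_smul, norm_smul t e, Real.norm_of_nonneg ht, hAe] at h
    have h2 := (abs_le.1 h).2
    simp only [smul_eq_mul] at h2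
    nlinarith
  · have h := hball' x hx y hy
    set z := x - y
    have hz : z = (z + A z • e) - A z • e := by simp
    have hzn : ‖z‖ ≤ ‖z + A z • e‖ + |A z| * ‖e‖ := by
      conv_lhs => rw [hz]
      exact (norm_sub_le _ _).trans (by rw [norm_smul, Real.norm_eq_abs])
    rw [hxy, sub_self, zero_sub, abs_neg] at h
    have h3 : |A z| ≤ ‖z + A z • e‖ := by
      have := mul_le_mul_of_nonneg_left hzn hc.le
      have h4 := mul_le_mul_of_nonneg_right hc1 (norm_nonneg (z + A z • e))
      have h5 := mul_le_mul_of_nonneg_right hce (abs_nonneg (A z))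
      nlinarith
    nlinarith [mul_le_mul_of_nonneg_right h3 (norm_nonneg e)]

variable [MeasurableSpace E] [BorelSpace E] [FiniteDimensional ℝ E]

/-- A `C¹` graph in direction `e` over the hyperplane `ker A`, thickened in the direction `e`:
integrals over the graph of integrals over the fibres are dominated by volume integrals. -/
theorem exists_lintegral_tube_le (μ : Measure E) [μ.IsAddHaarMeasure] {n : ℕ}
    (hn : Module.finrank ℝ E = n + 1) {A : E →L[ℝ] ℝ} {e : E} (hAe : A e = -1) {K U : Set E}
    (hK : IsCompact K) (hU : MeasurableSet U) {L : ℝ}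
    (hL : ∀ x ∈ K, ∀ y ∈ K, ‖x - y‖ ≤ L * ‖(x - y) + A (x - y) • e‖) {δ : ℝ}
    (hKU : ∀ x ∈ K, ∀ t ∈ Ioc 0 δ, x + t • e ∈ U) :
    ∃ C : ℝ≥0∞, C ≠ ∞ ∧ ∀ g : E → ℝ≥0∞, Measurable g →
      ∫⁻ x in K, (∫⁻ t in Ioc 0 δ, g (x + t • e)) ∂(μHE[n] : Measure E)
        ≤ C * ∫⁻ x in U, g x ∂μ := by
  let F := LinearMap.ker A.toLinearMap
  have hA0 : A.toLinearMap ≠ 0 := by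
    intro h
    have : A.toLinearMap e = 0 := by rw [h]; rfl
    simp [hAe] at this
  have hFn : Module.finrank ℝ F = n := by
    have := Module.Dual.finrank_ker_add_one_of_ne_zero (f := A.toLinearMap) hA0
    rw [hn] at this
    exact Nat.add_right_cancel this
  -- The projection along `e`; it lands in the kernel of `A` because `A e = -1`.
  let π : E →L[ℝ] F := (ContinuousLinearMap.id ℝ E + A.smulRight e).codRestrict F (by
    intro x
    simp [F, hAe])
  have hπ : ∀ x, ((π x : F) : E) = x + A x • e := fun x => rfl
  let Φ : (F × ℝ) ≃L[ℝ] E := ContinuousLinearEquiv.equivOfInverse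
    (F.subtypeL.coprod ((ContinuousLinearMap.id ℝ ℝ).smulRight e)) (π.prod (-A))
    (by
      rintro ⟨⟨y, hy⟩, u⟩
      have hy' : A y = 0 := hy
      ext <;> simp [hπ, hy', hAe])
    (by
      intro x
      simp [hπ])
  have hΦ : ∀ y u, Φ (y, u) = (y : E) + u • e := fun y u => rfl
  let ν : Measure F := μHE[n]
  have hν : ν.IsAddHaarMeasure := by
    have : (μHE[Module.finrank ℝ F] : Measure F).IsAddHaarMeasure := inferInstance
    rwa [hFn] at this
  let m : Measure E := (ν.prod (volume : Measure ℝ)).map Φ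
  have hm : m.IsAddHaarMeasure := Φ.isAddHaarMeasure_map _
  have hmμ : m = Measure.addHaarScalarFactor m μ • μ := Measure.isAddLeftInvariant_eq_smul m μ
  set L' : NNReal := Real.toNNReal L
  -- `K` is the graph of `s` over its projection, and `hL` says that `s` is Lipschitz there. Hence
  -- the Hausdorff measure on `K` is dominated by a multiple of the push-forward of the Haar measure
  -- `ν` under `s`.
  let s : F → E := Function.invFunOn π K
  have hsK : ∀ y ∈ π '' K, s y ∈ K := fun y hy => Function.invFunOn_mem hy
  have hsπ : ∀ y ∈ π '' K, π (s y) = y := fun y hy => Function.invFunOn_eq hy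
  have hsub : ∀ x y, ((π x - π y : F) : E) = (x - y) + A (x - y) • e := by
    intro x y
    rw [← map_sub, hπ]
  have hinj : ∀ x ∈ K, s (π x) = x := by
    intro x hx
    have hx' : π x ∈ π '' K := mem_image_of_mem _ hx
    have h := hL _ (hsK _ hx') _ hx
    rw [← hsub, hsπ _ hx', sub_self] at h
    simpa [sub_eq_zero] using h
  have hlip : LipschitzOnWith L' s (π '' K) := by
    refine LipschitzOnWith.of_dist_le_mul fun y hy z hz => ?_
    rw [dist_eq_norm, dist_eq_norm]
    refine (hL _ (hsK y hy) _ (hsK z hz)).trans ?_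
    rw [← hsub, hsπ y hy, hsπ z hz]
    exact mul_le_mul_of_nonneg_right (Real.le_coe_toNNReal L) (norm_nonneg _)
  have hπK : IsCompact (π '' K) := hK.image π.continuous
  have hs : AEMeasurable s (ν.restrict (π '' K)) :=
    hlip.continuousOn.aemeasurable hπK.measurableSet
  have himage : ∀ S ⊆ π '' K, (μHE[n] : Measure E) (s '' S) ≤ (L' : ℝ≥0∞) ^ n * ν S := by
    intro S hS
    have := (hlip.mono hS).hausdorffMeasure_image_le (d := n) n.cast_nonneg
    simp only [ν, Measure.euclideanHausdorffMeasure_def, Measure.smul_apply, ENNReal.smul_def,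
      smul_eq_mul]
    rw [ENNReal.rpow_natCast] at this
    rw [mul_left_comm]
    gcongr
  have hle : (μHE[n] : Measure E).restrict K
      ≤ (L' : ℝ≥0∞) ^ n • (ν.restrict (π '' K)).map s := by
    refine Measure.le_iff.2 fun S hS => ?_
    rw [Measure.restrict_apply hS, Measure.smul_apply, Measure.map_apply_of_aemeasurable hs hS,
      Measure.restrict_apply' hπK.measurableSet, smul_eq_mul]
    refine le_trans (measure_mono ?_) (himage _ inter_subset_right)
    rintro x ⟨hxS, hxK⟩
    refine ⟨π x, ⟨?_, mem_image_of_mem _ hxK⟩, hinj x hxK⟩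
    rw [mem_preimage, hinj x hxK]
    exact hxS
  refine ⟨(L' : ℝ≥0∞) ^ n * Measure.addHaarScalarFactor m μ, by finiteness, fun g hg => ?_⟩
  have hgU : Measurable (U.indicator g) := hg.indicator hU
  calc ∫⁻ x in K, (∫⁻ t in Ioc 0 δ, g (x + t • e)) ∂(μHE[n] : Measure E)
      ≤ ∫⁻ x, (∫⁻ t in Ioc 0 δ, g (x + t • e))
          ∂((L' : ℝ≥0∞) ^ n • (ν.restrict (π '' K)).map s) := lintegral_mono' hle le_rfl
    _ ≤ (L' : ℝ≥0∞) ^ n * ∫⁻ y in π '' K, (∫⁻ t in Ioc 0 δ, g (s y + t • e)) ∂ν := by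
        rw [lintegral_smul_measure, smul_eq_mul]
        gcongr
        exact lintegral_map_le (fun x => ∫⁻ t in Ioc 0 δ, g (x + t • e)) s
    _ ≤ (L' : ℝ≥0∞) ^ n * ∫⁻ y, (∫⁻ u, U.indicator g (Φ (y, u))) ∂ν := by
        refine mul_le_mul_right ?_ _
        refine le_trans ?_ (setLIntegral_le_lintegral (π '' K) _)
        refine setLIntegral_mono' hπK.measurableSet fun y hy => ?_
        -- As `s y = y - A (s y) • e`, the fibre through `s y` is the line through `y` in direction
        -- `e`, with parameter shifted by `A (s y)`.
        rw [← lintegral_sub_right_eq_self (μ := volume) (fun u => U.indicator g (Φ (y, u)))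
          (A (s y)), ← lintegral_indicator measurableSet_Ioc]
        refine lintegral_mono fun t => ?_
        by_cases ht : t ∈ Ioc 0 δ
        · have hpt : Φ (y, t - A (s y)) = s y + t • e := by
            rw [hΦ, ← hsπ y hy, hπ, hsπ y hy]
            module
          rw [indicator_of_mem ht, hpt, indicator_of_mem (hKU _ (hsK y hy) t ht)]
        · rw [indicator_of_notMem ht]
          exact zero_le
    _ = (L' : ℝ≥0∞) ^ n * ∫⁻ x, U.indicator g x ∂m := by
        rw [lintegral_map hgU Φ.continuous.measurable,
          lintegral_prod _ (by exact (hgU.comp Φ.continuous.measurable).aemeasurable)]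
    _ = _ := by
        conv_lhs => rw [hmμ]
        rw [lintegral_smul_measure, lintegral_indicator hU, mul_assoc]
        rfl

/-- On each fibre, `ξ x` differs from `ξ (x + t • e)` by at most `‖e‖` times the integral of the
derivative. Averaging over `t ∈ (0, δ]` bounds `‖ξ x‖` by fibre integrals, which the tube estimate
turns into volume integrals over `U`. -/
theorem exists_setLIntegral_trace_le (μ : Measure E) [μ.IsAddHaarMeasure] {n : ℕ}
    (hn : Module.finrank ℝ E = n + 1) {A : E →L[ℝ] ℝ} {e : E} (hAe : A e = -1) {K U : Set E}
    (hK : IsCompact K) (hU : MeasurableSet U) {L : ℝ}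
    (hL : ∀ x ∈ K, ∀ y ∈ K, ‖x - y‖ ≤ L * ‖(x - y) + A (x - y) • e‖) {δ : ℝ} (hδ : 0 < δ)
    (hKU : ∀ x ∈ K, ∀ t ∈ Ioc 0 δ, x + t • e ∈ U) :
    ∃ C : ℝ≥0∞, C ≠ ∞ ∧ ∀ ξ : E → ℝ, ContDiff ℝ 1 ξ →
      ∫⁻ x in K, ‖ξ x‖ₑ ∂(μHE[n] : Measure E)
        ≤ C * ((∫⁻ x in U, ‖ξ x‖ₑ ∂μ) + ∫⁻ x in U, ‖fderiv ℝ ξ x‖ₑ ∂μ) := by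
  obtain ⟨C, hC, hg⟩ := exists_lintegral_tube_le μ hn hAe hK hU hL hKU
  have hδ0 : ENNReal.ofReal δ ≠ 0 := (ENNReal.ofReal_pos.2 hδ).ne'
  refine ⟨(ENNReal.ofReal δ)⁻¹ * ((1 + ENNReal.ofReal δ * ‖e‖ₑ) * C), by finiteness,
    fun ξ hξ => ?_⟩
  have hd : Continuous (fderiv ℝ ξ) := hξ.continuous_fderiv one_ne_zero
  have hpt : ∀ x, ‖ξ x‖ₑ ≤ (ENNReal.ofReal δ)⁻¹ * ((1 + ENNReal.ofReal δ * ‖e‖ₑ) *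
      ∫⁻ t in Ioc 0 δ, (‖ξ (x + t • e)‖ₑ + ‖fderiv ℝ ξ (x + t • e)‖ₑ)) := by
    intro x
    have hc1 : Continuous fun t : ℝ => ‖ξ (x + t • e)‖ₑ :=
      (hξ.continuous.comp (by fun_prop)).enorm
    have h1 : ENNReal.ofReal δ * ‖ξ x‖ₑ ≤ (∫⁻ t in Ioc 0 δ, ‖ξ (x + t • e)‖ₑ)
        + ENNReal.ofReal δ * ‖e‖ₑ * ∫⁻ t in Ioc 0 δ, ‖fderiv ℝ ξ (x + t • e)‖ₑ := by
      calc ENNReal.ofReal δ * ‖ξ x‖ₑ = ∫⁻ _t in Ioc 0 δ, ‖ξ x‖ₑ := by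
            rw [setLIntegral_const, Real.volume_Ioc, sub_zero, mul_comm]
        _ ≤ ∫⁻ t in Ioc 0 δ, (‖ξ (x + t • e)‖ₑ
              + ‖e‖ₑ * ∫⁻ u in Ioc 0 δ, ‖fderiv ℝ ξ (x + u • e)‖ₑ) := by
            refine setLIntegral_mono (hc1.measurable.add measurable_const) fun t ht => ?_
            have h2 : ξ x = ξ (x + t • e) - (ξ (x + t • e) - ξ x) := by ring
            conv_lhs => rw [h2]
            refine (enorm_sub_le).trans ?_
            gcongr
            refine (enorm_sub_le_lintegral_fderiv hξ x e ht.1.le).trans ?_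
            gcongr
            exact ht.2
        _ = _ := by
            rw [lintegral_add_left hc1.measurable, setLIntegral_const, Real.volume_Ioc, sub_zero]
            ring
    calc ‖ξ x‖ₑ = (ENNReal.ofReal δ)⁻¹ * (ENNReal.ofReal δ * ‖ξ x‖ₑ) := by
          rw [← mul_assoc, ENNReal.inv_mul_cancel hδ0 ENNReal.ofReal_ne_top, one_mul]
      _ ≤ _ := by
          refine mul_le_mul_right (h1.trans ?_) _
          rw [lintegral_add_left hc1.measurable, mul_add]
          gcongr
          · exact le_mul_of_one_le_left' le_self_add
          · exact le_add_self
  have hmeas : Measurable fun x => ‖ξ x‖ₑ + ‖fderiv ℝ ξ x‖ₑ :=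
    hξ.continuous.enorm.measurable.add hd.enorm.measurable
  have hmeas' : Measurable fun x => ∫⁻ t in Ioc 0 δ,
      (‖ξ (x + t • e)‖ₑ + ‖fderiv ℝ ξ (x + t • e)‖ₑ) := by
    have : Measurable fun q : E × ℝ => q.1 + q.2 • e :=
      Continuous.measurable (by fun_prop)
    exact (hmeas.comp this).lintegral_prod_right'
  calc ∫⁻ x in K, ‖ξ x‖ₑ ∂(μHE[n] : Measure E)
      ≤ ∫⁻ x in K, (ENNReal.ofReal δ)⁻¹ * ((1 + ENNReal.ofReal δ * ‖e‖ₑ) *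
          ∫⁻ t in Ioc 0 δ, (‖ξ (x + t • e)‖ₑ + ‖fderiv ℝ ξ (x + t • e)‖ₑ))
            ∂(μHE[n] : Measure E) := lintegral_mono hpt
    _ = (ENNReal.ofReal δ)⁻¹ * ((1 + ENNReal.ofReal δ * ‖e‖ₑ) *
          ∫⁻ x in K, (∫⁻ t in Ioc 0 δ, (‖ξ (x + t • e)‖ₑ + ‖fderiv ℝ ξ (x + t • e)‖ₑ))
            ∂(μHE[n] : Measure E)) := by
        rw [lintegral_const_mul _ (hmeas'.const_mul _), lintegral_const_mul _ hmeas']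
    _ ≤ (ENNReal.ofReal δ)⁻¹ * ((1 + ENNReal.ofReal δ * ‖e‖ₑ) *
          (C * ∫⁻ x in U, (‖ξ x‖ₑ + ‖fderiv ℝ ξ x‖ₑ) ∂μ)) := by
        gcongr
        exact hg _ hmeas
    _ = _ := by
        rw [lintegral_add_left hξ.continuous.enorm.measurable]
        ring

end Transversal

/-! ### Boundary charts, and the Poincaré and trace inequalities on the domain -/

section Domain

variable {d : ℕ} {Ω : Set (EuclideanSpace ℝ (Fin d))}

theorem IsSmoothDomain.isClosed (hΩ : IsSmoothDomain Ω) : IsClosed Ω := hΩ.isCompact.isClosed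

theorem IsSmoothDomain.frontier_subset (hΩ : IsSmoothDomain Ω) : frontier Ω ⊆ Ω :=
  hΩ.isClosed.frontier_subset

theorem IsSmoothDomain.isCompact_frontier (hΩ : IsSmoothDomain Ω) : IsCompact (frontier Ω) :=
  hΩ.isCompact.of_isClosed_subset isClosed_frontier hΩ.frontier_subset

theorem IsSmoothDomain.exists_defining (hΩ : IsSmoothDomain Ω) {p : EuclideanSpace ℝ (Fin d)}
    (hp : p ∈ frontier Ω) : ∃ r : EuclideanSpace ℝ (Fin d) → ℝ, ContDiff ℝ (⊤ : ℕ∞) r ∧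
      ∃ ε > 0, ∀ x ∈ Metric.ball p ε, fderiv ℝ r x ≠ 0 ∧ (x ∈ Ω ↔ r x ≤ 0) ∧
        (x ∈ interior Ω ↔ r x < 0) ∧ (x ∈ frontier Ω ↔ r x = 0) := by
  obtain ⟨r, hr, hrp, hΩr⟩ := hΩ.smooth_boundary p hp
  have hdr : Continuous (fderiv ℝ r) := hr.continuous_fderiv (by simp)
  have hne : ∀ᶠ x in 𝓝 p, fderiv ℝ r x ≠ 0 := hdr.continuousAt.eventually_ne hrp
  obtain ⟨ε, hε, hball⟩ := Metric.eventually_nhds_iff_ball.1 (hne.and hΩr)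
  have hint : ∀ x ∈ Metric.ball p ε, (x ∈ interior Ω ↔ r x < 0) := by
    intro x hx
    constructor
    · intro hxi
      -- An interior point of `Ω` with `r = 0` would be a local maximum of `r`, which is impossible
      -- where the derivative does not vanish.
      refine lt_of_le_of_ne ((hball x hx).2.1 (interior_subset hxi)) fun h0 => ?_
      refine (hball x hx).1 (IsLocalMax.fderiv_eq_zero ?_)
      filter_upwards [mem_interior_iff_mem_nhds.1 hxi, Metric.isOpen_ball.mem_nhds hx]
        with y hy hyb
      rw [h0]
      exact (hball y hyb).2.1 hy
    · intro hx0
      rw [mem_interior_iff_mem_nhds]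
      filter_upwards [Metric.isOpen_ball.mem_nhds hx,
        (isOpen_lt hr.continuous continuous_const).mem_nhds hx0] with y hyb hy
      exact (hball y hyb).2.2 (le_of_lt hy)
  refine ⟨r, hr, ε, hε, fun x hx => ⟨(hball x hx).1, (hball x hx).2, hint x hx, ?_⟩⟩
  rw [hΩ.isClosed.frontier_eq, Set.mem_sdiff, (hball x hx).2, hint x hx, not_lt, le_antisymm_iff]

/-- Flowing along the transversal direction decreases `r`, so it pushes points of `Ω` into the
interior. At time `δ` the drop is large enough to carry a whole ball around `p`, including its part
outside `Ω`, into the interior; this ball is the convex target for linking. -/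
theorem IsSmoothDomain.exists_chart (hΩ : IsSmoothDomain Ω) {p : EuclideanSpace ℝ (Fin d)}
    (hp : p ∈ frontier Ω) : ∃ (A : EuclideanSpace ℝ (Fin d) →L[ℝ] ℝ)
      (e : EuclideanSpace ℝ (Fin d)), A e = -1 ∧ ∃ ε > 0, ∃ δ : ℝ, 0 < δ ∧
        (∀ x ∈ Ω ∩ Metric.closedBall p ε, ∀ t ∈ Ioc 0 δ, x + t • e ∈ interior Ω) ∧
        Metric.closedBall (p + δ • e) ε ⊆ interior Ω ∧
        ∀ x ∈ frontier Ω ∩ Metric.closedBall p ε, ∀ y ∈ frontier Ω ∩ Metric.closedBall p ε,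
          ‖x - y‖ ≤ (1 + ‖e‖) * ‖(x - y) + A (x - y) • e‖ := by
  obtain ⟨r, hr, ε₁, hε₁, hball⟩ := hΩ.exists_defining hp
  have hstrict : HasStrictFDerivAt r (fderiv ℝ r p) p :=
    hr.contDiffAt.hasStrictFDerivAt (by simp)
  obtain ⟨e, hAe, ε₂, hε₂, hdec, hanti⟩ :=
    exists_transversal hstrict (hball p (Metric.mem_ball_self hε₁)).1
  set ε₀ := min ε₁ ε₂ with hε₀def
  have hε₀ : 0 < ε₀ := lt_min hε₁ hε₂
  have hb1 : ∀ {x}, x ∈ Metric.ball p ε₀ → x ∈ Metric.ball p ε₁ := fun h =>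
    Metric.ball_subset_ball (min_le_left _ _) h
  have hb2 : ∀ {x}, x ∈ Metric.ball p ε₀ → x ∈ Metric.ball p ε₂ := fun h =>
    Metric.ball_subset_ball (min_le_right _ _) h
  -- `δ * ‖e‖ ≤ ε₀ / 2` and, below, `ε ≤ ε₀ / 3` keep the flow inside the ball of radius `ε₀`. The
  -- choice `ε ≤ ε₃ / 2` gives `r < δ / 2` on the closed ball, less than the drop by time `δ`.
  set δ := ε₀ / (2 * (‖e‖ + 1)) with hδdef
  have hδ : 0 < δ := by positivity
  have hδe : δ * ‖e‖ ≤ ε₀ / 2 := by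
    rw [hδdef, div_mul_eq_mul_div, div_le_div_iff₀ (by positivity) (by positivity)]
    nlinarith [norm_nonneg e]
  have hrp : r p = 0 := (hball p (Metric.mem_ball_self hε₁)).2.2.2.1 hp
  have hev : ∀ᶠ x in 𝓝 p, r x < δ / 2 :=
    hr.continuous.continuousAt.eventually_lt continuousAt_const (by rw [hrp]; positivity)
  obtain ⟨ε₃, hε₃, hball₃⟩ := Metric.eventually_nhds_iff_ball.1 hev
  set ε := min (ε₀ / 3) (ε₃ / 2) with hεdef
  have hε : 0 < ε := by positivity
  have hε0 : ε ≤ ε₀ / 3 := min_le_left _ _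
  have hε3 : ε ≤ ε₃ / 2 := min_le_right _ _
  have hin : ∀ x ∈ Metric.closedBall p ε, ∀ t, 0 ≤ t → t ≤ δ → x + t • e ∈ Metric.ball p ε₀ := by
    intro x hx t ht htδ
    rw [Metric.mem_closedBall, dist_eq_norm] at hx
    rw [Metric.mem_ball, dist_eq_norm]
    calc ‖x + t • e - p‖ = ‖(x - p) + t • e‖ := by congr 1; abel
      _ ≤ ‖x - p‖ + t * ‖e‖ := (norm_add_le _ _).trans (by rw [norm_smul, Real.norm_of_nonneg ht])
      _ ≤ ε₀ / 3 + ε₀ / 2 := by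
          have := mul_le_mul_of_nonneg_right htδ (norm_nonneg e)
          linarith
      _ < ε₀ := by linarith
  have hin0 : ∀ x ∈ Metric.closedBall p ε, x ∈ Metric.ball p ε₀ := fun x hx => by
    simpa using hin x hx 0 le_rfl hδ.le
  refine ⟨fderiv ℝ r p, e, hAe, ε, hε, δ, hδ, ?_, ?_, ?_⟩
  · rintro x ⟨hxΩ, hx⟩ t ht
    have hxt := hin x hx t ht.1.le ht.2
    rw [(hball _ (hb1 hxt)).2.2.1]
    have h1 := hdec x (hb2 (hin0 x hx)) t ht.1.le (hb2 hxt)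
    have h2 := (hball x (hb1 (hin0 x hx))).2.1.1 hxΩ
    linarith [ht.1]
  · intro y hy
    have hx : y - δ • e ∈ Metric.closedBall p ε := by
      rw [Metric.mem_closedBall, dist_eq_norm] at hy ⊢
      convert hy using 2
      abel
    have hxt := hin _ hx δ hδ.le le_rfl
    have h1 := hdec _ (hb2 (hin0 _ hx)) δ hδ.le (hb2 hxt)
    have h2 : r (y - δ • e) < δ / 2 :=
      hball₃ _ (Metric.closedBall_subset_ball (by linarith) hx)
    rw [sub_add_cancel] at hxt h1
    rw [(hball _ (hb1 hxt)).2.2.1]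
    linarith
  · rintro x ⟨hxf, hx⟩ y ⟨hyf, hy⟩
    refine hanti x (hb2 (hin0 x hx)) y (hb2 (hin0 y hy)) ?_
    rw [(hball x (hb1 (hin0 x hx))).2.2.2.1 hxf, (hball y (hb1 (hin0 y hy))).2.2.2.1 hyf]

theorem IsSmoothDomain.subset_closure_interior (hΩ : IsSmoothDomain Ω) :
    Ω ⊆ closure (interior Ω) := by
  intro p hp
  by_cases hpi : p ∈ interior Ω
  · exact subset_closure hpi
  obtain ⟨A, e, -, ε, hε, δ, hδ, hin, -, -⟩ :=
    hΩ.exists_chart (hΩ.isClosed.frontier_eq ▸ ⟨hp, hpi⟩ : p ∈ frontier Ω)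
  have hlim : Tendsto (fun t : ℝ => p + t • e) (𝓝[>] 0) (𝓝 p) := by
    have : Continuous fun t : ℝ => p + t • e := by fun_prop
    simpa using (this.tendsto 0).mono_left nhdsWithin_le_nhds
  refine mem_closure_of_tendsto hlim ?_
  filter_upwards [Ioc_mem_nhdsGT hδ] with t ht
  exact hin p ⟨hp, Metric.mem_closedBall_self hε.le⟩ t ht

/-- Interior points have convex neighbourhoods, and near a boundary point the chart translates the
interior part of a small ball into a ball inside `Ω`. -/
theorem IsSmoothDomain.linked_interior (hΩ : IsSmoothDomain Ω) :
    Linked volume (interior Ω) (interior Ω) (interior Ω) := by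
  refine linked_self_of_locally hΩ.isCompact hΩ.isConnected.isPreconnected isOpen_interior
    interior_subset hΩ.subset_closure_interior fun p hp => ?_
  have hmeas : MeasurableSet (interior Ω) := isOpen_interior.measurableSet
  by_cases hpi : p ∈ interior Ω
  · obtain ⟨ε, hε, hball⟩ := Metric.isOpen_iff.1 isOpen_interior p hpi
    refine ⟨Metric.ball p ε, Metric.ball_mem_nhds p hε, ?_⟩
    rw [inter_eq_left.2 hball]
    exact linked_self_of_convex hmeas Metric.isOpen_ball.measurableSet hball (convex_ball p ε)
      Metric.isBounded_ball
  · obtain ⟨A, e, -, ε, hε, δ, hδ, hin, hball, -⟩ :=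
      hΩ.exists_chart (hΩ.isClosed.frontier_eq ▸ ⟨hp, hpi⟩ : p ∈ frontier Ω)
    refine ⟨Metric.closedBall p ε, Metric.closedBall_mem_nhds p hε, ?_⟩
    refine linked_self_of_translate (D := Metric.closedBall (p + δ • e) ε) hmeas
      (measurableSet_closedBall.inter hmeas) measurableSet_closedBall hball
      (convex_closedBall _ _) Metric.isBounded_closedBall
      (Metric.measure_closedBall_pos _ _ hε).ne' ?_ (δ • e) ?_ ?_
    · exact (Metric.isBounded_closedBall.subset inter_subset_left).measure_lt_top.ne
    · rintro x ⟨hx, hxi⟩ t ht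
      rw [smul_smul]
      exact hin x ⟨interior_subset hxi, hx⟩ _
        ⟨mul_pos ht.1 hδ, mul_le_of_le_one_left hδ.le ht.2⟩
    · rintro x ⟨hx, -⟩
      simpa using hx

/-- The trace inequality in `L¹`. -/
theorem IsSmoothDomain.exists_lintegral_surface_le (hd : 1 ≤ d) (hΩ : IsSmoothDomain Ω) :
    ∃ C : ℝ≥0∞, C ≠ ∞ ∧ ∀ ξ : EuclideanSpace ℝ (Fin d) → ℝ, ContDiff ℝ 1 ξ →
      ∫⁻ x, ‖ξ x‖ₑ ∂(surface Ω)
        ≤ C * ((∫⁻ x, ‖ξ x‖ₑ ∂(bulk Ω)) + ∫⁻ x, ‖fderiv ℝ ξ x‖ₑ ∂(bulk Ω)) := by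
  -- Repeating `frontier Ω` frees one copy to serve as the variable set in the compactness
  -- induction.
  suffices ∃ C : ℝ≥0∞, C ≠ ∞ ∧ ∀ ξ : EuclideanSpace ℝ (Fin d) → ℝ, ContDiff ℝ 1 ξ →
      ∫⁻ x in frontier Ω ∩ frontier Ω, ‖ξ x‖ₑ ∂(μHE[d - 1])
        ≤ C * ((∫⁻ x, ‖ξ x‖ₑ ∂(bulk Ω)) + ∫⁻ x, ‖fderiv ℝ ξ x‖ₑ ∂(bulk Ω)) by
    rwa [inter_self] at this
  refine hΩ.isCompact_frontier.induction_on (p := fun S => ∃ C : ℝ≥0∞, C ≠ ∞ ∧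
    ∀ ξ : EuclideanSpace ℝ (Fin d) → ℝ, ContDiff ℝ 1 ξ →
      ∫⁻ x in frontier Ω ∩ S, ‖ξ x‖ₑ ∂(μHE[d - 1])
        ≤ C * ((∫⁻ x, ‖ξ x‖ₑ ∂(bulk Ω)) + ∫⁻ x, ‖fderiv ℝ ξ x‖ₑ ∂(bulk Ω))) ?_ ?_ ?_ ?_
  · exact ⟨0, by simp, by simp⟩
  · rintro S T hST ⟨C, hC, h⟩
    exact ⟨C, hC, fun ξ hξ => (lintegral_mono_set (by gcongr)).trans (h ξ hξ)⟩
  · rintro S T ⟨C, hC, h⟩ ⟨C', hC', h'⟩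
    refine ⟨C + C', by finiteness, fun ξ hξ => ?_⟩
    rw [inter_union_distrib_left, add_mul]
    exact (lintegral_union_le _ _ _).trans (add_le_add (h ξ hξ) (h' ξ hξ))
  · intro p hp
    obtain ⟨A, e, hAe, ε, hε, δ, hδ, hin, -, hL⟩ := hΩ.exists_chart hp
    refine ⟨Metric.closedBall p ε, mem_nhdsWithin_of_mem_nhds (Metric.closedBall_mem_nhds p hε), ?_⟩
    exact exists_setLIntegral_trace_le volume (by simp; omega) hAe
      (hΩ.isCompact_frontier.inter_right Metric.isClosed_closedBall)
      isOpen_interior.measurableSet hL hδ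
      fun x hx => hin x ⟨hΩ.frontier_subset hx.1, hx.2⟩

theorem IsSmoothDomain.isFiniteMeasure_bulk (hΩ : IsSmoothDomain Ω) :
    IsFiniteMeasure (bulk Ω) :=
  ⟨by
    rw [bulk, Measure.restrict_apply_univ]
    exact (measure_mono interior_subset).trans_lt hΩ.isCompact.measure_lt_top⟩

/-- The trace inequality applied to the constant `1` bounds the surface measure by the finite
volume. -/
theorem IsSmoothDomain.isFiniteMeasure_surface (hd : 1 ≤ d) (hΩ : IsSmoothDomain Ω) :
    IsFiniteMeasure (surface Ω) := by
  obtain ⟨C, hC, h⟩ := hΩ.exists_lintegral_surface_le hd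
  have := hΩ.isFiniteMeasure_bulk
  have h1 := h (fun _ => 1) contDiff_const
  have h2 : ∀ x, ‖fderiv ℝ (fun _ : EuclideanSpace ℝ (Fin d) => (1 : ℝ)) x‖ₑ = 0 := fun x => by
    rw [fderiv_fun_const, ← ofReal_norm, Pi.zero_apply, norm_zero, ENNReal.ofReal_zero]
  simp only [enorm_one, lintegral_one, h2, lintegral_zero, add_zero] at h1
  exact ⟨h1.trans_lt (ENNReal.mul_lt_top hC.lt_top (measure_lt_top _ _))⟩

theorem IsSmoothDomain.bulk_univ_ne_zero (hΩ : IsSmoothDomain Ω) : bulk Ω univ ≠ 0 := by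
  rw [bulk, Measure.restrict_apply_univ]
  exact (isOpen_interior.measure_pos _ hΩ.nonempty_interior).ne'

theorem IsSmoothDomain.integrable_of_continuous (hΩ : IsSmoothDomain Ω) {F : Type*}
    [NormedAddCommGroup F] [SecondCountableTopology F] {ξ : EuclideanSpace ℝ (Fin d) → F}
    (hξ : Continuous ξ) : Integrable ξ (bulk Ω) :=
  (hξ.continuousOn.integrableOn_compact hΩ.isCompact).mono_set interior_subset

/-- The Poincaré inequality in `L¹`, including the trace on the boundary. -/
theorem IsSmoothDomain.exists_poincare (hd : 1 ≤ d) (hΩ : IsSmoothDomain Ω) :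
    ∃ C : ℝ≥0∞, C ≠ ∞ ∧ ∀ ξ : EuclideanSpace ℝ (Fin d) → ℝ, ContDiff ℝ 1 ξ →
      ∫ x, ξ x ∂(bulk Ω) = 0 →
        ∫⁻ x, ‖ξ x‖ₑ ∂(bulk Ω + surface Ω) ≤ C * ∫⁻ x, ‖fderiv ℝ ξ x‖ₑ ∂(bulk Ω) := by
  obtain ⟨C, hC, hP⟩ := hΩ.linked_interior
  obtain ⟨C', hC', hT⟩ := hΩ.exists_lintegral_surface_le hd
  have := hΩ.isFiniteMeasure_bulk
  have hμ0 := hΩ.bulk_univ_ne_zero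
  have hμ : bulk Ω univ ≠ ∞ := measure_ne_top _ _
  set m := bulk Ω univ
  refine ⟨m⁻¹ * C + C' * (m⁻¹ * C + 1), by finiteness, fun ξ hξ h0 => ?_⟩
  have hi := hΩ.integrable_of_continuous hξ.continuous
  -- For `ξ` of mean zero, `m * ξ x` is the integral of `ξ x - ξ y` over `y`.
  have hpt : ∀ x, m * ‖ξ x‖ₑ ≤ ∫⁻ y, ‖ξ x - ξ y‖ₑ ∂(bulk Ω) := by
    intro x
    have h1 : ∫ y, (ξ x - ξ y) ∂(bulk Ω) = (bulk Ω).real univ * ξ x := by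
      rw [integral_sub (integrable_const _) hi, h0]
      simp
    have h2 := enorm_integral_le_lintegral_enorm (μ := bulk Ω) fun y => ξ x - ξ y
    rw [h1, enorm_mul] at h2
    convert h2 using 2
    rw [Real.enorm_of_nonneg measureReal_nonneg, ofReal_measureReal]
  have hbulk : ∫⁻ x, ‖ξ x‖ₑ ∂(bulk Ω) ≤ m⁻¹ * C * ∫⁻ x, ‖fderiv ℝ ξ x‖ₑ ∂(bulk Ω) := by
    calc ∫⁻ x, ‖ξ x‖ₑ ∂(bulk Ω) = m⁻¹ * ∫⁻ x, m * ‖ξ x‖ₑ ∂(bulk Ω) := by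
          rw [lintegral_const_mul _ hξ.continuous.enorm.measurable, ← mul_assoc,
            ENNReal.inv_mul_cancel hμ0 hμ, one_mul]
      _ ≤ m⁻¹ * ∫⁻ x, ∫⁻ y, ‖ξ x - ξ y‖ₑ ∂(bulk Ω) ∂(bulk Ω) := by
          gcongr with x
          exact hpt x
      _ ≤ _ := by
          rw [mul_assoc]
          gcongr
          exact hP ξ hξ
  rw [lintegral_add_measure, add_mul]
  gcongr
  refine (hT ξ hξ).trans ?_
  rw [mul_assoc, add_mul, one_mul]
  gcongr

end Domain

/-! ### Tangent spaces and continuity of the tangential gradient -/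

section Tangent

variable {d : ℕ} {Ω : Set (EuclideanSpace ℝ (Fin d))}

/-- Near `x`, `f` is constant on the level set of `r`, so `x` is a constrained extremum. As the
derivative of `r` is nonzero, the Lagrange multiplier rule makes the derivative of `f` a multiple of
it. -/
theorem fderiv_apply_eq_zero_of_vanishing {r f : EuclideanSpace ℝ (Fin d) → ℝ}
    {x v : EuclideanSpace ℝ (Fin d)} (hr : ContDiff ℝ (⊤ : ℕ∞) r) (hf : ContDiff ℝ (⊤ : ℕ∞) f)
    (hrx : fderiv ℝ r x ≠ 0) (hfx : ∀ᶠ y in 𝓝 x, r y = r x → f y = f x)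
    (hv : fderiv ℝ r x v = 0) : fderiv ℝ f x v = 0 := by
  have hextr : IsLocalExtrOn f {y | r y = r x} x := by
    refine Or.inl ?_
    have : ∀ᶠ y in 𝓝[{y | r y = r x}] x, f x ≤ f y :=
      eventually_nhdsWithin_iff.2 (hfx.mono fun y hy hry => (hy hry).ge)
    exact this
  obtain ⟨a, b, hab, h⟩ := hextr.exists_multipliers_of_hasStrictFDerivAt_1d
    (hr.contDiffAt.hasStrictFDerivAt (by simp)) (hf.contDiffAt.hasStrictFDerivAt (by simp))
  have hb : b ≠ 0 := by
    rintro rfl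
    have ha : a ≠ 0 := fun ha => hab (by rw [ha]; rfl)
    rw [zero_smul, add_zero] at h
    exact hrx ((smul_eq_zero.1 h).resolve_left ha)
  have h2 := congrArg (fun φ : EuclideanSpace ℝ (Fin d) →L[ℝ] ℝ => φ v) h
  simp only [_root_.add_apply, _root_.smul_apply, hv, smul_zero,
    zero_add, _root_.zero_apply] at h2
  exact (smul_eq_zero.1 h2).resolve_left hb

theorem IsSmoothDomain.exists_boundaryTangent_eq (hΩ : IsSmoothDomain Ω)
    {p : EuclideanSpace ℝ (Fin d)} (hp : p ∈ frontier Ω) :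
    ∃ r : EuclideanSpace ℝ (Fin d) → ℝ, ContDiff ℝ (⊤ : ℕ∞) r ∧
      ∀ᶠ x in 𝓝 p, fderiv ℝ r x ≠ 0 ∧
        (x ∈ frontier Ω → ∀ v, v ∈ boundaryTangent Ω x ↔ fderiv ℝ r x v = 0) := by
  obtain ⟨r, hr, ε, hε, hball⟩ := hΩ.exists_defining hp
  let χ : ContDiffBump p := ⟨ε / 3, ε / 2, by positivity, by linarith⟩
  refine ⟨r, hr, ?_⟩
  filter_upwards [Metric.ball_mem_nhds p (by positivity : 0 < ε / 3)] with x hx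
  have hxε : x ∈ Metric.ball p ε := Metric.ball_subset_ball (by linarith) hx
  refine ⟨(hball x hxε).1, fun hxf v => ⟨fun hv => ?_, fun hv f hf hf0 => ?_⟩⟩
  -- `r` is known to vanish on the boundary only near `p`, while tangency is tested on functions
  -- vanishing on all of it; hence the cutoff, equal to `1` near `x`.
  · have hχr : ContDiff ℝ (⊤ : ℕ∞) fun y => χ y * r y := χ.contDiff.mul hr
    have heq : (fun y => χ y * r y) =ᶠ[𝓝 x] r := by
      filter_upwards [Metric.isOpen_ball.mem_nhds hx] with y hy
      rw [χ.one_of_mem_closedBall (Metric.ball_subset_closedBall hy), one_mul]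
    rw [← heq.fderiv_eq]
    refine hv _ hχr fun y hy => ?_
    by_cases hyε : y ∈ Metric.ball p ε
    · rw [(hball y hyε).2.2.2.1 hy, mul_zero]
    · rw [χ.zero_of_le_dist, zero_mul]
      rw [Metric.mem_ball, not_lt] at hyε
      change ε / 2 ≤ _
      linarith
  · refine fderiv_apply_eq_zero_of_vanishing hr hf (hball x hxε).1 ?_ hv
    filter_upwards [Metric.isOpen_ball.mem_nhds hxε] with y hy hry
    have hyf : y ∈ frontier Ω := by
      rw [(hball y hy).2.2.2, hry, ← (hball x hxε).2.2.2]
      exact hxf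
    rw [hf0 y hyf, hf0 x hxf]

theorem continuous_gradient {ξ : EuclideanSpace ℝ (Fin d) → ℝ} (hξ : ContDiff ℝ (⊤ : ℕ∞) ξ) :
    Continuous (∇ ξ) :=
  (InnerProductSpace.toDual ℝ _).symm.continuous.comp (hξ.continuous_fderiv (by simp))

/-- Locally the tangent space is the orthogonal complement of `∇ r`, so the projection has an
explicit formula with nonvanishing denominator `‖∇ r‖ ^ 2`. This supplies the measurability of
tangential gradients. -/
theorem IsSmoothDomain.continuousOn_tangentialGradient (hΩ : IsSmoothDomain Ω)
    {ξ : EuclideanSpace ℝ (Fin d) → ℝ} (hξ : ContDiff ℝ (⊤ : ℕ∞) ξ) :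
    ContinuousOn (tangentialGradient Ω ξ) (frontier Ω) := by
  intro p hp
  obtain ⟨r, hr, hev⟩ := hΩ.exists_boundaryTangent_eq hp
  have hcr := continuous_gradient hr
  have hcξ := continuous_gradient hξ
  have hgr : ∀ x, fderiv ℝ r x ≠ 0 → ∇ r x ≠ 0 := fun x hx h =>
    hx ((LinearIsometryEquiv.map_eq_zero_iff (InnerProductSpace.toDual ℝ _).symm).1 h)
  have hp0 : ‖∇ r p‖ ^ 2 ≠ 0 := by
    have := hgr p hev.self_of_nhds.1
    simpa using this
  have hcont : ContinuousAt
      (fun x => ∇ ξ x - (inner ℝ (∇ r x) (∇ ξ x) / ‖∇ r x‖ ^ 2) • ∇ r x) p := by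
    have h1 : ContinuousAt (fun x => inner ℝ (∇ r x) (∇ ξ x) / ‖∇ r x‖ ^ 2) p :=
      (hcr.inner hcξ).continuousAt.div (hcr.norm.pow 2).continuousAt hp0
    exact hcξ.continuousAt.sub (h1.smul hcr.continuousAt)
  refine hcont.continuousWithinAt.congr_of_eventuallyEq_of_mem ?_ hp
  filter_upwards [mem_nhdsWithin_of_mem_nhds hev, self_mem_nhdsWithin] with x hx hxf
  have hT : boundaryTangent Ω x = (ℝ ∙ ∇ r x)ᗮ := by
    ext v
    rw [hx.2 hxf, Submodule.mem_orthogonal_singleton_iff_inner_right]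
    simp [gradient]
  rw [tangentialGradient]
  simp only [hT]
  rw [Submodule.starProjection_orthogonal_val,
    Submodule.starProjection_singleton]
  rfl

theorem norm_tangentialGradient_le (ξ : EuclideanSpace ℝ (Fin d) → ℝ)
    (x : EuclideanSpace ℝ (Fin d)) : ‖tangentialGradient Ω ξ x‖ ≤ ‖∇ ξ x‖ :=
  Submodule.norm_starProjection_apply_le _ _

theorem tangentialGradient_mem (ξ : EuclideanSpace ℝ (Fin d) → ℝ)
    (x : EuclideanSpace ℝ (Fin d)) : tangentialGradient Ω ξ x ∈ boundaryTangent Ω x :=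
  Submodule.starProjection_apply_mem _ _

theorem enorm_gradient (ξ : EuclideanSpace ℝ (Fin d) → ℝ) (x : EuclideanSpace ℝ (Fin d)) :
    ‖∇ ξ x‖ₑ = ‖fderiv ℝ ξ x‖ₑ := by
  rw [← ofReal_norm, ← ofReal_norm, gradient, LinearIsometryEquiv.norm_map]

theorem gradient_add {ξ η : EuclideanSpace ℝ (Fin d) → ℝ} (hξ : ContDiff ℝ (⊤ : ℕ∞) ξ)
    (hη : ContDiff ℝ (⊤ : ℕ∞) η) (x : EuclideanSpace ℝ (Fin d)) :
    ∇ (fun y => ξ y + η y) x = ∇ ξ x + ∇ η x := by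
  rw [gradient, fderiv_fun_add (hξ.differentiable (by simp) x) (hη.differentiable (by simp) x),
    map_add]
  rfl

theorem gradient_const_mul {ξ : EuclideanSpace ℝ (Fin d) → ℝ} (hξ : ContDiff ℝ (⊤ : ℕ∞) ξ)
    (c : ℝ) (x : EuclideanSpace ℝ (Fin d)) : ∇ (fun y => c * ξ y) x = c • ∇ ξ x := by
  rw [gradient, fderiv_const_mul (hξ.differentiable (by simp) x), map_smul]
  rfl

theorem gradient_add_const (ξ : EuclideanSpace ℝ (Fin d) → ℝ)
    (c : ℝ) (x : EuclideanSpace ℝ (Fin d)) : ∇ (fun y => ξ y + c) x = ∇ ξ x := by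
  rw [gradient, fderiv_add_const]
  rfl

theorem tangentialGradient_add {ξ η : EuclideanSpace ℝ (Fin d) → ℝ}
    (hξ : ContDiff ℝ (⊤ : ℕ∞) ξ) (hη : ContDiff ℝ (⊤ : ℕ∞) η) (x : EuclideanSpace ℝ (Fin d)) :
    tangentialGradient Ω (fun y => ξ y + η y) x
      = tangentialGradient Ω ξ x + tangentialGradient Ω η x := by
  simp only [tangentialGradient, gradient_add hξ hη, map_add]

theorem tangentialGradient_const_mul {ξ : EuclideanSpace ℝ (Fin d) → ℝ}
    (hξ : ContDiff ℝ (⊤ : ℕ∞) ξ) (c : ℝ) (x : EuclideanSpace ℝ (Fin d)) :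
    tangentialGradient Ω (fun y => c * ξ y) x = c • tangentialGradient Ω ξ x := by
  simp only [tangentialGradient, gradient_const_mul hξ, map_smul]

theorem tangentialGradient_add_const (ξ : EuclideanSpace ℝ (Fin d) → ℝ) (c : ℝ)
    (x : EuclideanSpace ℝ (Fin d)) :
    tangentialGradient Ω (fun y => ξ y + c) x = tangentialGradient Ω ξ x := by
  simp only [tangentialGradient, gradient_add_const]

end Tangent

/-! ### Weighted estimates and completeness of the energy space -/

section EnergyEstimates

variable {d : ℕ} {Ω : Set (EuclideanSpace ℝ (Fin d))} {ω γ : EuclideanSpace ℝ (Fin d) → ℝ}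

theorem IsDensityPair.aemeasurable_interior (hρ : IsDensityPair Ω ω γ) :
    AEMeasurable (fun x => ENNReal.ofReal (ω x)) (bulk Ω) :=
  hρ.integrable_interior.aestronglyMeasurable.aemeasurable.ennreal_ofReal

theorem IsDensityPair.aemeasurable_boundary (hρ : IsDensityPair Ω ω γ) :
    AEMeasurable (fun x => ENNReal.ofReal (γ x)) (surface Ω) :=
  hρ.integrable_boundary.aestronglyMeasurable.aemeasurable.ennreal_ofReal

theorem IsDensityPair.isFiniteMeasure_bulkMass (hρ : IsDensityPair Ω ω γ) :
    IsFiniteMeasure (bulkMass Ω ω) :=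
  isFiniteMeasure_withDensity_ofReal hρ.integrable_interior.2

theorem IsDensityPair.isFiniteMeasure_surfaceMass (hρ : IsDensityPair Ω ω γ) :
    IsFiniteMeasure (surfaceMass Ω γ) :=
  isFiniteMeasure_withDensity_ofReal hρ.integrable_boundary.2

theorem bulkMass_absolutelyContinuous : bulkMass Ω ω ≪ bulk Ω :=
  withDensity_absolutelyContinuous _ _

theorem surfaceMass_absolutelyContinuous : surfaceMass Ω γ ≪ surface Ω :=
  withDensity_absolutelyContinuous _ _

theorem IsDensityPair.surface_absolutelyContinuous (hρ : IsDensityPair Ω ω γ) :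
    surface Ω ≪ surfaceMass Ω γ :=
  withDensity_absolutelyContinuous' hρ.aemeasurable_boundary
    (hρ.pos_boundary.mono fun _ hx => (ENNReal.ofReal_pos.2 hx).ne')

theorem eLpNorm_two_sq {α F : Type*} [MeasurableSpace α] [NormedAddCommGroup F] (f : α → F)
    (μ : Measure α) : eLpNorm f 2 μ ^ 2 = ∫⁻ x, ‖f x‖ₑ ^ 2 ∂μ := by
  have := eLpNorm_nnreal_pow_eq_lintegral (f := f) (μ := μ) (p := 2) two_ne_zero
  simpa using this

theorem memLp_two_of_lintegral {α F : Type*} [MeasurableSpace α] [NormedAddCommGroup F]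
    {f : α → F} {μ : Measure α} (hf : AEStronglyMeasurable f μ) (h : ∫⁻ x, ‖f x‖ₑ ^ 2 ∂μ < ∞) :
    MemLp f 2 μ := by
  refine ⟨hf, lt_top_iff_ne_top.2 fun htop => ?_⟩
  rw [← eLpNorm_two_sq, htop] at h
  simp at h

/-- The Cauchy–Schwarz inequality for the density `ω` and its reciprocal. -/
theorem IsDensityPair.exists_lintegral_bulk_le (hρ : IsDensityPair Ω ω γ) :
    ∃ C : ℝ≥0∞, C ≠ ∞ ∧ ∀ f : EuclideanSpace ℝ (Fin d) → EuclideanSpace ℝ (Fin d),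
      AEStronglyMeasurable f (bulk Ω) →
        ∫⁻ x, ‖f x‖ₑ ∂(bulk Ω) ≤ C * eLpNorm f 2 (bulkMass Ω ω) := by
  have hinv : AEMeasurable (fun x => ENNReal.ofReal (ω x)⁻¹) (bulk Ω) :=
    hρ.integrable_inv_interior.aestronglyMeasurable.aemeasurable.ennreal_ofReal
  refine ⟨(∫⁻ x, ENNReal.ofReal (ω x)⁻¹ ∂(bulk Ω)) ^ (1 / 2 : ℝ), ?_, fun f hf => ?_⟩
  · have := hρ.integrable_inv_interior.lintegral_lt_top
    finiteness
  calc ∫⁻ x, ‖f x‖ₑ ∂(bulk Ω)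
      = ∫⁻ x, ((fun x => ENNReal.ofReal (ω x)⁻¹ ^ (1 / 2 : ℝ)) *
          fun x => ‖f x‖ₑ * ENNReal.ofReal (ω x) ^ (1 / 2 : ℝ)) x ∂(bulk Ω) := by
        refine lintegral_congr_ae (hρ.pos_interior.mono fun x hx => ?_)
        have h1 : ENNReal.ofReal (ω x)⁻¹ ^ (1 / 2 : ℝ) * ENNReal.ofReal (ω x) ^ (1 / 2 : ℝ)
            = 1 := by
          rw [← ENNReal.mul_rpow_of_nonneg _ _ (by norm_num),
            ← ENNReal.ofReal_mul (inv_nonneg.2 hx.le), inv_mul_cancel₀ hx.ne']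
          simp
        simp only [Pi.mul_apply]
        rw [mul_left_comm, h1, mul_one]
    _ ≤ (∫⁻ x, (ENNReal.ofReal (ω x)⁻¹ ^ (1 / 2 : ℝ)) ^ (2 : ℝ) ∂(bulk Ω)) ^ (1 / 2 : ℝ)
          * (∫⁻ x, (‖f x‖ₑ * ENNReal.ofReal (ω x) ^ (1 / 2 : ℝ)) ^ (2 : ℝ) ∂(bulk Ω))
            ^ (1 / 2 : ℝ) :=
        ENNReal.lintegral_mul_le_Lp_mul_Lq _ Real.HolderConjugate.two_two
          (hinv.pow_const _) (hf.enorm.mul (hρ.aemeasurable_interior.pow_const _))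
    _ = _ := by
        have h2 : ∀ z : ℝ≥0∞, (z ^ (1 / 2 : ℝ)) ^ (2 : ℝ) = z := fun z => by
          rw [← ENNReal.rpow_mul]; norm_num
        have h3 : eLpNorm f 2 (bulkMass Ω ω)
            = (∫⁻ x, ‖f x‖ₑ ^ (2 : ℝ) ∂(bulkMass Ω ω)) ^ (1 / 2 : ℝ) := by
          have := eLpNorm_nnreal_eq_lintegral (f := f) (μ := bulkMass Ω ω) (p := 2) two_ne_zero
          simpa using this
        simp only [h2]
        rw [h3, bulkMass, lintegral_withDensity_eq_lintegral_mul₀ hρ.aemeasurable_interior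
          (hf.enorm.pow_const _)]
        congr 2
        refine lintegral_congr fun x => ?_
        rw [ENNReal.mul_rpow_of_nonneg _ _ (by norm_num), h2, Pi.mul_apply, mul_comm]

theorem IsSmoothDomain.exists_bound (hΩ : IsSmoothDomain Ω) {F : Type*} [NormedAddCommGroup F]
    {f : EuclideanSpace ℝ (Fin d) → F} (hf : Continuous f) : ∃ C, ∀ x ∈ Ω, ‖f x‖ ≤ C :=
  hΩ.isCompact.exists_bound_of_continuousOn hf.continuousOn

theorem IsSmoothDomain.ae_bulk_mem : ∀ᵐ x ∂(bulk Ω), x ∈ Ω :=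
  (ae_restrict_mem isOpen_interior.measurableSet).mono fun _ hx => interior_subset hx

theorem IsSmoothDomain.ae_surface_mem (hΩ : IsSmoothDomain Ω) : ∀ᵐ x ∂(surface Ω), x ∈ Ω :=
  (ae_restrict_mem isClosed_frontier.measurableSet).mono fun _ hx => hΩ.frontier_subset hx

theorem IsSmoothDomain.memLp_gradient (hΩ : IsSmoothDomain Ω) (hρ : IsDensityPair Ω ω γ)
    {ξ : EuclideanSpace ℝ (Fin d) → ℝ} (hξ : ContDiff ℝ (⊤ : ℕ∞) ξ) :
    MemLp (∇ ξ) 2 (bulkMass Ω ω) := by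
  have := hρ.isFiniteMeasure_bulkMass
  obtain ⟨C, hC⟩ := hΩ.exists_bound (continuous_gradient hξ)
  exact MemLp.of_bound (continuous_gradient hξ).aestronglyMeasurable C
    (bulkMass_absolutelyContinuous.ae_le (IsSmoothDomain.ae_bulk_mem.mono hC))

theorem IsSmoothDomain.memLp_tangentialGradient (hΩ : IsSmoothDomain Ω) (hρ : IsDensityPair Ω ω γ)
    {ξ : EuclideanSpace ℝ (Fin d) → ℝ} (hξ : ContDiff ℝ (⊤ : ℕ∞) ξ) :
    MemLp (tangentialGradient Ω ξ) 2 (surfaceMass Ω γ) := by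
  have := hρ.isFiniteMeasure_surfaceMass
  obtain ⟨C, hC⟩ := hΩ.exists_bound (continuous_gradient hξ)
  have hm : AEStronglyMeasurable (tangentialGradient Ω ξ) (surface Ω) :=
    (hΩ.continuousOn_tangentialGradient hξ).aestronglyMeasurable isClosed_frontier.measurableSet
  exact MemLp.of_bound (hm.mono_ac surfaceMass_absolutelyContinuous) C
    (surfaceMass_absolutelyContinuous.ae_le (hΩ.ae_surface_mem.mono fun x hx =>
      (norm_tangentialGradient_le ξ x).trans (hC x hx)))

theorem IsSmoothDomain.memLp_one (hd : 1 ≤ d) (hΩ : IsSmoothDomain Ω)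
    {ξ : EuclideanSpace ℝ (Fin d) → ℝ} (hξ : Continuous ξ) :
    MemLp ξ 1 (bulk Ω + surface Ω) := by
  have := hΩ.isFiniteMeasure_bulk
  have := hΩ.isFiniteMeasure_surface hd
  obtain ⟨C, hC⟩ := hΩ.exists_bound hξ
  exact MemLp.of_bound hξ.aestronglyMeasurable C (ae_add_measure_iff.2
    ⟨IsSmoothDomain.ae_bulk_mem.mono hC, hΩ.ae_surface_mem.mono hC⟩)

theorem exists_poincare_energy (hd : 1 ≤ d) (hΩ : IsSmoothDomain Ω) (hρ : IsDensityPair Ω ω γ) :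
    ∃ C : ℝ≥0∞, C ≠ ∞ ∧ ∀ ξ : EuclideanSpace ℝ (Fin d) → ℝ, ContDiff ℝ (⊤ : ℕ∞) ξ →
      eLpNorm (fun x => ξ x - ⨍ y, ξ y ∂(bulk Ω)) 1 (bulk Ω + surface Ω)
        ≤ C * eLpNorm (∇ ξ) 2 (bulkMass Ω ω) := by
  obtain ⟨C, hC, hP⟩ := hΩ.exists_poincare hd
  obtain ⟨C', hC', hH⟩ := hρ.exists_lintegral_bulk_le
  have := hΩ.isFiniteMeasure_bulk
  refine ⟨C * C', by finiteness, fun ξ hξ => ?_⟩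
  have h := hP (fun x => ξ x - ⨍ y, ξ y ∂(bulk Ω))
    ((hξ.of_le (by exact_mod_cast le_top)).sub contDiff_const) (integral_sub_average _ _)
  rw [eLpNorm_one_eq_lintegral_enorm, mul_assoc]
  refine h.trans ?_
  gcongr
  simp only [fderiv_sub_const, ← enorm_gradient]
  exact hH _ (continuous_gradient hξ).aestronglyMeasurable

theorem eLpNorm_one_add_measure {α : Type*} [MeasurableSpace α] (f : α → ℝ) (μ ν : Measure α) :
    eLpNorm f 1 (μ + ν) = eLpNorm f 1 μ + eLpNorm f 1 ν := by
  simp only [eLpNorm_one_eq_lintegral_enorm, lintegral_add_measure]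

theorem HasEnergyGradient.memLp {φ : EuclideanSpace ℝ (Fin d) → ℝ} {G : VelocityPair d}
    (h : HasEnergyGradient Ω ω γ φ G) : MemLp φ 1 (bulk Ω + surface Ω) :=
  ⟨aestronglyMeasurable_add_measure_iff.2 ⟨h.memLp_interior.1, h.memLp_boundary.1⟩, by
    rw [eLpNorm_one_add_measure]
    exact ENNReal.add_lt_top.2 ⟨h.memLp_interior.2, h.memLp_boundary.2⟩⟩

/-- By Poincaré, the approximants minus their interior means tend to zero in L¹(λ+σ), and these
means converge to the mean of `φ`. One constant therefore serves both the interior and the trace,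
although only the interior gradient is assumed to vanish. -/
theorem HasEnergyGradient.exists_ae_eq_const (hd : 1 ≤ d) (hΩ : IsSmoothDomain Ω)
    (hρ : IsDensityPair Ω ω γ) {φ : EuclideanSpace ℝ (Fin d) → ℝ} {G : VelocityPair d}
    (h : HasEnergyGradient Ω ω γ φ G) (hG : G.inner =ᵐ[bulkMass Ω ω] 0) :
    ∃ c : ℝ, φ =ᵐ[bulk Ω + surface Ω] fun _ => c := by
  obtain ⟨C, hC, hP⟩ := exists_poincare_energy hd hΩ hρ
  obtain ⟨ξ, hξ, hbulk, hsurf, hgrad, -⟩ := h.approx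
  have := hΩ.isFiniteMeasure_bulk
  have := hΩ.isFiniteMeasure_surface hd
  set μ := bulk Ω + surface Ω
  have hξφ : Tendsto (fun n => eLpNorm (fun x => ξ n x - φ x) 1 μ) atTop (𝓝 0) := by
    simp only [μ, eLpNorm_one_add_measure]
    simpa using hbulk.add hsurf
  have hmean : Tendsto (fun n => ⨍ y, ξ n y ∂(bulk Ω)) atTop (𝓝 (⨍ y, φ y ∂(bulk Ω))) := by
    simp only [average_eq]
    refine Tendsto.const_smul (tendsto_integral_of_L1 φ h.memLp_interior.1
      (Eventually.of_forall fun n => hΩ.integrable_of_continuous (hξ n).continuous) ?_) _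
    simpa only [eLpNorm_one_eq_lintegral_enorm] using hbulk
  set c := ⨍ y, φ y ∂(bulk Ω)
  have hgrad0 : Tendsto (fun n => eLpNorm (∇ (ξ n)) 2 (bulkMass Ω ω)) atTop (𝓝 0) := by
    refine hgrad.congr fun n => eLpNorm_congr_ae ?_
    filter_upwards [hG] with x hx
    rw [hx, Pi.zero_apply, sub_zero]
  have hosc : Tendsto (fun n => eLpNorm (fun x => ξ n x - ⨍ y, ξ n y ∂(bulk Ω)) 1 μ)
      atTop (𝓝 0) := by
    refine tendsto_of_tendsto_of_tendsto_of_le_of_le tendsto_const_nhds ?_ (fun _ => zero_le)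
      fun n => hP (ξ n) (hξ n)
    simpa using ENNReal.Tendsto.const_mul hgrad0 (Or.inr hC)
  have hconst : Tendsto (fun n => eLpNorm (fun _ : EuclideanSpace ℝ (Fin d) =>
      (⨍ y, ξ n y ∂(bulk Ω)) - c) 1 μ) atTop (𝓝 0) := by
    simp only [eLpNorm_one_eq_lintegral_enorm, lintegral_const]
    have h1 : Tendsto (fun n => ‖(⨍ y, ξ n y ∂(bulk Ω)) - c‖ₑ) atTop (𝓝 0) := by
      have := (hmean.sub_const c).enorm
      simpa using this
    simpa using ENNReal.Tendsto.mul_const h1 (Or.inr (measure_ne_top μ univ))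
  refine ⟨c, ?_⟩
  have hφm := h.memLp.1
  have hzero : eLpNorm (fun x => φ x - c) 1 μ = 0 := by
    refine le_antisymm (ge_of_tendsto' (by simpa using (hξφ.add hosc).add hconst) fun n => ?_)
      zero_le
    have hmξ : AEStronglyMeasurable (ξ n) μ := (hξ n).continuous.aestronglyMeasurable
    have heq : (fun x => φ x - c) = (-(fun x => ξ n x - φ x)
        + fun x => ξ n x - ⨍ y, ξ n y ∂(bulk Ω)) + fun _ => (⨍ y, ξ n y ∂(bulk Ω)) - c := by
      ext x
      simp only [Pi.add_apply, Pi.neg_apply]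
      ring
    rw [heq, ← eLpNorm_neg (fun x => ξ n x - φ x)]
    refine (eLpNorm_add_le ((hmξ.sub hφm).neg.add (hmξ.sub aestronglyMeasurable_const))
      aestronglyMeasurable_const le_rfl).trans ?_
    gcongr
    exact eLpNorm_add_le (hmξ.sub hφm).neg (hmξ.sub aestronglyMeasurable_const) le_rfl
  filter_upwards [(eLpNorm_eq_zero_iff (hφm.sub aestronglyMeasurable_const)
    one_ne_zero).1 hzero] with x hx
  simpa [sub_eq_zero] using hx

/-- Convergent gradients alone suffice: once the interior means are subtracted, the Poincaré
inequality makes the functions Cauchy in L¹(λ+σ), and the gradients are unchanged. -/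
theorem exists_hasEnergyGradient (hd : 1 ≤ d) (hΩ : IsSmoothDomain Ω)
    (hρ : IsDensityPair Ω ω γ) {ξ : ℕ → EuclideanSpace ℝ (Fin d) → ℝ} {G : VelocityPair d}
    (hG : MemLp G.inner 2 (bulkMass Ω ω)) (hG' : MemLp G.bdry 2 (surfaceMass Ω γ))
    (hξ : ∀ n, ContDiff ℝ (⊤ : ℕ∞) (ξ n))
    (hgrad : Tendsto (fun n => eLpNorm (fun x => ∇ (ξ n) x - G.inner x) 2 (bulkMass Ω ω))
      atTop (𝓝 0))
    (htan : Tendsto (fun n => eLpNorm (fun x => tangentialGradient Ω (ξ n) x - G.bdry x) 2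
      (surfaceMass Ω γ)) atTop (𝓝 0)) :
    ∃ φ, HasEnergyGradient Ω ω γ φ G := by
  obtain ⟨C, hC, hP⟩ := exists_poincare_energy hd hΩ hρ
  set μ := bulk Ω + surface Ω with hμ
  have hbμ : bulk Ω ≤ μ := Measure.le_add_right le_rfl
  have hsμ : surface Ω ≤ μ := Measure.le_add_left le_rfl
  let η : ℕ → EuclideanSpace ℝ (Fin d) → ℝ := fun n x => ξ n x + -⨍ y, ξ n y ∂(bulk Ω)
  have hη : ∀ n, ContDiff ℝ (⊤ : ℕ∞) (η n) := fun n => (hξ n).add contDiff_const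
  have hmem : ∀ n, MemLp (η n) 1 μ := fun n => hΩ.memLp_one hd (hη n).continuous
  have hmξ : ∀ n, AEStronglyMeasurable (∇ (ξ n)) (bulkMass Ω ω) := fun n =>
    (continuous_gradient (hξ n)).aestronglyMeasurable
  have hdiff : ∀ n m, eLpNorm (η n - η m) 1 μ
      ≤ C * (eLpNorm (fun x => ∇ (ξ n) x - G.inner x) 2 (bulkMass Ω ω)
        + eLpNorm (fun x => ∇ (ξ m) x - G.inner x) 2 (bulkMass Ω ω)) := by
    intro n m
    have hmul : ContDiff ℝ (⊤ : ℕ∞) fun x => (-1 : ℝ) * ξ m x := contDiff_const.mul (hξ m)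
    have h := hP (fun x => ξ n x + (-1 : ℝ) * ξ m x) ((hξ n).add hmul)
    have hi : ∀ n, Integrable (ξ n) (bulk Ω) := fun n =>
      hΩ.integrable_of_continuous (hξ n).continuous
    have h1 : (fun x => (ξ n x + (-1 : ℝ) * ξ m x)
        - ⨍ y, (ξ n y + (-1 : ℝ) * ξ m y) ∂(bulk Ω)) = η n - η m := by
      ext x
      simp only [η, average_eq, Pi.sub_apply]
      rw [integral_add (hi n) ((hi m).const_mul _), integral_const_mul]
      simp only [smul_eq_mul]
      ring
    rw [h1] at h
    refine h.trans ?_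
    gcongr
    have h2 : ∇ (fun x => ξ n x + (-1 : ℝ) * ξ m x)
        = (fun x => ∇ (ξ n) x - G.inner x) - fun x => ∇ (ξ m) x - G.inner x := by
      ext1 x
      rw [gradient_add (hξ n) hmul, gradient_const_mul (hξ m), Pi.sub_apply]
      module
    rw [h2]
    exact eLpNorm_sub_le ((hmξ n).sub hG.1) ((hmξ m).sub hG.1) one_le_two
  have hcauchy : CauchySeq fun n => (hmem n).toLp (η n) := by
    rw [Lp.cauchySeq_Lp_iff_cauchySeq_eLpNorm]
    refine tendsto_of_tendsto_of_tendsto_of_le_of_le tendsto_const_nhds ?_ (fun _ => zero_le)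
      fun n => (le_of_eq (eLpNorm_congr_ae
        ((hmem n.1).coeFn_toLp.sub (hmem n.2).coeFn_toLp))).trans (hdiff n.1 n.2)
    rw [← prod_atTop_atTop_eq]
    simpa using ENNReal.Tendsto.const_mul
      ((hgrad.comp tendsto_fst).add (hgrad.comp tendsto_snd)) (Or.inr hC)
  obtain ⟨φ, hφ⟩ := cauchySeq_tendsto_of_complete hcauchy
  have hφm : MemLp φ 1 μ := Lp.memLp φ
  have hlim : Tendsto (fun n => eLpNorm (fun x => η n x - φ x) 1 μ) atTop (𝓝 0) := by
    rw [← Lp.toLp_coeFn φ hφm, Lp.tendsto_Lp_iff_tendsto_eLpNorm'' _ hmem] at hφ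
    exact hφ
  refine ⟨φ, hφm.mono_measure hbμ, hφm.mono_measure hsμ, hG, hG', η, hη, ?_, ?_, ?_, ?_⟩
  · exact tendsto_of_tendsto_of_tendsto_of_le_of_le tendsto_const_nhds hlim (fun _ => zero_le)
      fun n => eLpNorm_mono_measure _ hbμ
  · exact tendsto_of_tendsto_of_tendsto_of_le_of_le tendsto_const_nhds hlim (fun _ => zero_le)
      fun n => eLpNorm_mono_measure _ hsμ
  · simpa only [η, gradient_add_const] using hgrad
  · simpa only [η, tangentialGradient_add_const] using htan

theorem HasEnergyGradient.add_const (hd : 1 ≤ d) (hΩ : IsSmoothDomain Ω)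
    {φ ψ : EuclideanSpace ℝ (Fin d) → ℝ} {G : VelocityPair d}
    (h : HasEnergyGradient Ω ω γ φ G) {c : ℝ}
    (hψ : ψ =ᵐ[bulk Ω + surface Ω] fun x => φ x + c) : HasEnergyGradient Ω ω γ ψ G := by
  have := hΩ.isFiniteMeasure_bulk
  have := hΩ.isFiniteMeasure_surface hd
  obtain ⟨hb, hs⟩ := ae_add_measure_iff.1 hψ
  obtain ⟨ξ, hξ, hbulk, hsurf, hgrad, htan⟩ := h.approx
  refine ⟨(memLp_congr_ae hb).2 (h.memLp_interior.add (memLp_const c)),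
    (memLp_congr_ae hs).2 (h.memLp_boundary.add (memLp_const c)), h.memLp_gradient,
    h.memLp_tangentialGradient, fun n x => ξ n x + c, fun n => (hξ n).add contDiff_const,
    ?_, ?_, ?_, ?_⟩
  · refine hbulk.congr fun n => eLpNorm_congr_ae ?_
    filter_upwards [hb] with x hx
    rw [hx, add_sub_add_right_eq_sub]
  · refine hsurf.congr fun n => eLpNorm_congr_ae ?_
    filter_upwards [hs] with x hx
    rw [hx, add_sub_add_right_eq_sub]
  · simpa only [gradient_add_const] using hgrad
  · simpa only [tangentialGradient_add_const] using htan

theorem tendsto_eLpNorm_sub_sub {α F : Type*} [MeasurableSpace α] [NormedAddCommGroup F]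
    {μ : Measure α} {p : ℝ≥0∞} (hp : 1 ≤ p) {f g : ℕ → α → F} {f₀ g₀ : α → F}
    (hf : ∀ n, AEStronglyMeasurable (f n) μ) (hg : ∀ n, AEStronglyMeasurable (g n) μ)
    (hf₀ : AEStronglyMeasurable f₀ μ) (hg₀ : AEStronglyMeasurable g₀ μ)
    (hff : Tendsto (fun n => eLpNorm (fun x => f n x - f₀ x) p μ) atTop (𝓝 0))
    (hgg : Tendsto (fun n => eLpNorm (fun x => g n x - g₀ x) p μ) atTop (𝓝 0)) :
    Tendsto (fun n => eLpNorm (fun x => (f n x - g n x) - (f₀ x - g₀ x)) p μ) atTop (𝓝 0) := by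
  refine tendsto_of_tendsto_of_tendsto_of_le_of_le tendsto_const_nhds
    (by simpa using hff.add hgg) (fun _ => zero_le) fun n => ?_
  have : (fun x => (f n x - g n x) - (f₀ x - g₀ x))
      = (fun x => f n x - f₀ x) - fun x => g n x - g₀ x := by
    ext x
    simp only [Pi.sub_apply]
    abel
  rw [this]
  exact eLpNorm_sub_le ((hf n).sub hf₀) ((hg n).sub hg₀) hp

theorem HasEnergyGradient.sub (hΩ : IsSmoothDomain Ω) (hρ : IsDensityPair Ω ω γ)
    {φ ψ : EuclideanSpace ℝ (Fin d) → ℝ} {G H : VelocityPair d}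
    (h : HasEnergyGradient Ω ω γ φ G) (h' : HasEnergyGradient Ω ω γ ψ H) :
    HasEnergyGradient Ω ω γ (fun x => φ x - ψ x)
      ⟨fun x => G.inner x - H.inner x, fun x => G.bdry x - H.bdry x⟩ := by
  obtain ⟨ξ, hξ, hbulk, hsurf, hgrad, htan⟩ := h.approx
  obtain ⟨η, hη, hbulk', hsurf', hgrad', htan'⟩ := h'.approx
  have hmul : ∀ n, ContDiff ℝ (⊤ : ℕ∞) fun x => (-1 : ℝ) * η n x := fun n =>
    contDiff_const.mul (hη n)
  refine ⟨h.memLp_interior.sub h'.memLp_interior, h.memLp_boundary.sub h'.memLp_boundary,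
    h.memLp_gradient.sub h'.memLp_gradient,
    h.memLp_tangentialGradient.sub h'.memLp_tangentialGradient,
    fun n x => ξ n x + (-1 : ℝ) * η n x, fun n => (hξ n).add (hmul n), ?_, ?_, ?_, ?_⟩
  · simpa only [neg_one_mul, ← sub_eq_add_neg] using tendsto_eLpNorm_sub_sub le_rfl
      (fun n => (hξ n).continuous.aestronglyMeasurable)
      (fun n => (hη n).continuous.aestronglyMeasurable)
      h.memLp_interior.1 h'.memLp_interior.1 hbulk hbulk'
  · simpa only [neg_one_mul, ← sub_eq_add_neg] using tendsto_eLpNorm_sub_sub le_rfl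
      (fun n => (hξ n).continuous.aestronglyMeasurable)
      (fun n => (hη n).continuous.aestronglyMeasurable)
      h.memLp_boundary.1 h'.memLp_boundary.1 hsurf hsurf'
  · simp only [gradient_add (hξ _) (hmul _), gradient_const_mul (hη _), neg_one_smul,
      ← sub_eq_add_neg]
    exact tendsto_eLpNorm_sub_sub one_le_two (fun n => (hΩ.memLp_gradient hρ (hξ n)).1)
      (fun n => (hΩ.memLp_gradient hρ (hη n)).1) h.memLp_gradient.1 h'.memLp_gradient.1
      hgrad hgrad'
  · simp only [tangentialGradient_add (hξ _) (hmul _), tangentialGradient_const_mul (hη _),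
      neg_one_smul, ← sub_eq_add_neg]
    exact tendsto_eLpNorm_sub_sub one_le_two
      (fun n => (hΩ.memLp_tangentialGradient hρ (hξ n)).1)
      (fun n => (hΩ.memLp_tangentialGradient hρ (hη n)).1) h.memLp_tangentialGradient.1
      h'.memLp_tangentialGradient.1 htan htan'

end EnergyEstimates

/-! ### The Hilbert space of fields, orthogonal projection and minimality -/

section EnergySpace

variable {d : ℕ} {Ω : Set (EuclideanSpace ℝ (Fin d))} {ω γ : EuclideanSpace ℝ (Fin d) → ℝ}
  {a : ℝ}

/-- The Hilbert space of pairs of square-integrable vector fields, with squared norm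
`∫_{Ω°} |V_o|² ω + a ∫_{∂Ω} |V_∂|² γ`. -/
abbrev FieldSpace (Ω : Set (EuclideanSpace ℝ (Fin d))) (ω γ : EuclideanSpace ℝ (Fin d) → ℝ)
    (a : ℝ) : Type :=
  WithLp 2 (Lp (EuclideanSpace ℝ (Fin d)) 2 (bulkMass Ω ω) ×
    Lp (EuclideanSpace ℝ (Fin d)) 2 (ENNReal.ofReal a • surfaceMass Ω γ))

/-- The class of a pair of square-integrable vector fields. -/
noncomputable def VelocityPair.toField (a : ℝ) (G : VelocityPair d)
    (h : MemLp G.inner 2 (bulkMass Ω ω)) (h' : MemLp G.bdry 2 (surfaceMass Ω γ)) :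
    FieldSpace Ω ω γ a :=
  WithLp.toLp 2 (h.toLp, (h'.smul_measure ENNReal.ofReal_ne_top).toLp)

theorem VelocityPair.toField_fst {G : VelocityPair d}
    (h : MemLp G.inner 2 (bulkMass Ω ω)) (h' : MemLp G.bdry 2 (surfaceMass Ω γ)) :
    (G.toField a h h').fst = h.toLp := rfl

theorem VelocityPair.toField_snd {G : VelocityPair d}
    (h : MemLp G.inner 2 (bulkMass Ω ω)) (h' : MemLp G.bdry 2 (surfaceMass Ω γ)) :
    (G.toField a h h').snd = (h'.smul_measure ENNReal.ofReal_ne_top).toLp := rfl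

theorem inner_toField (ha : 0 < a) {G H : VelocityPair d}
    (hG : MemLp G.inner 2 (bulkMass Ω ω)) (hG' : MemLp G.bdry 2 (surfaceMass Ω γ))
    (hH : MemLp H.inner 2 (bulkMass Ω ω)) (hH' : MemLp H.bdry 2 (surfaceMass Ω γ)) :
    inner ℝ (G.toField a hG hG') (H.toField a hH hH')
      = (∫ x, inner ℝ (G.inner x) (H.inner x) ∂(bulkMass Ω ω))
        + a * ∫ x, inner ℝ (G.bdry x) (H.bdry x) ∂(surfaceMass Ω γ) := by
  rw [WithLp.prod_inner_apply, L2.inner_def, L2.inner_def]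
  congr 1
  · refine integral_congr_ae ?_
    filter_upwards [hG.coeFn_toLp, hH.coeFn_toLp] with x h1 h2
    simp only [VelocityPair.toField]
    rw [h1, h2]
  · have : ∫ x, inner ℝ (G.bdry x) (H.bdry x) ∂(ENNReal.ofReal a • surfaceMass Ω γ)
        = a * ∫ x, inner ℝ (G.bdry x) (H.bdry x) ∂(surfaceMass Ω γ) := by
      rw [integral_smul_measure, ENNReal.toReal_ofReal ha.le, smul_eq_mul]
    rw [← this]
    refine integral_congr_ae ?_
    filter_upwards [(hG'.smul_measure (ENNReal.ofReal_ne_top (r := a))).coeFn_toLp,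
      (hH'.smul_measure (ENNReal.ofReal_ne_top (r := a))).coeFn_toLp] with x h1 h2
    simp only [VelocityPair.toField]
    rw [h1, h2]

theorem enorm_toField_sq {G : VelocityPair d}
    (hG : MemLp G.inner 2 (bulkMass Ω ω)) (hG' : MemLp G.bdry 2 (surfaceMass Ω γ)) :
    ‖G.toField a hG hG'‖ₑ ^ 2 = potentialEnergy Ω ω γ a G := by
  have h1 : ‖G.toField a hG hG'‖₊ ^ 2 = ‖(G.toField a hG hG').fst‖₊ ^ 2
      + ‖(G.toField a hG hG').snd‖₊ ^ 2 := by
    rw [WithLp.prod_nnnorm_eq_of_L2, NNReal.sq_sqrt]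
  have h2 : ‖G.toField a hG hG'‖ₑ ^ 2 = ‖(G.toField a hG hG').fst‖ₑ ^ 2
      + ‖(G.toField a hG hG').snd‖ₑ ^ 2 := by
    simp only [enorm_eq_nnnorm]
    exact_mod_cast h1
  rw [h2]
  rw [VelocityPair.toField_fst, VelocityPair.toField_snd, Lp.enorm_toLp, Lp.enorm_toLp, eLpNorm_two_sq, eLpNorm_two_sq, lintegral_smul_measure]
  rfl

/-- The pairs of gradients of smooth functions. -/
noncomputable def gradients (Ω : Set (EuclideanSpace ℝ (Fin d)))
    (ω γ : EuclideanSpace ℝ (Fin d) → ℝ) (a : ℝ) : Submodule ℝ (FieldSpace Ω ω γ a) where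
  carrier := {x | ∃ ξ : EuclideanSpace ℝ (Fin d) → ℝ, ContDiff ℝ (⊤ : ℕ∞) ξ ∧
    x.fst =ᵐ[bulkMass Ω ω] ∇ ξ ∧
    x.snd =ᵐ[ENNReal.ofReal a • surfaceMass Ω γ] tangentialGradient Ω ξ}
  zero_mem' := by
    have h0 : ∇ (fun _ : EuclideanSpace ℝ (Fin d) => (0 : ℝ)) = 0 := by
      ext1 x
      simp [gradient]
    refine ⟨fun _ => 0, contDiff_const, ?_, ?_⟩
    · rw [h0]
      exact Lp.coeFn_zero _ _ _
    · have : tangentialGradient Ω (fun _ : EuclideanSpace ℝ (Fin d) => (0 : ℝ)) = 0 := by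
        ext1 x
        rw [tangentialGradient, h0, Pi.zero_apply, map_zero]
      rw [this]
      exact Lp.coeFn_zero _ _ _
  add_mem' := by
    rintro x y ⟨ξ, hξ, h1, h2⟩ ⟨η, hη, h3, h4⟩
    refine ⟨fun z => ξ z + η z, hξ.add hη, ?_, ?_⟩
    · refine (Lp.coeFn_add x.fst y.fst).trans ?_
      filter_upwards [h1, h3] with z hz hz'
      rw [Pi.add_apply, hz, hz', gradient_add hξ hη]
    · refine (Lp.coeFn_add x.snd y.snd).trans ?_
      filter_upwards [h2, h4] with z hz hz'
      rw [Pi.add_apply, hz, hz', tangentialGradient_add hξ hη]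
  smul_mem' := by
    rintro c x ⟨ξ, hξ, h1, h2⟩
    refine ⟨fun z => c * ξ z, contDiff_const.mul hξ, ?_, ?_⟩
    · refine (Lp.coeFn_smul c x.fst).trans ?_
      filter_upwards [h1] with z hz
      rw [Pi.smul_apply, hz, gradient_const_mul hξ]
    · refine (Lp.coeFn_smul c x.snd).trans ?_
      filter_upwards [h2] with z hz
      rw [Pi.smul_apply, hz, tangentialGradient_const_mul hξ]

/-- The pair of gradients of a smooth function. -/
noncomputable def gradientPair (Ω : Set (EuclideanSpace ℝ (Fin d)))
    (ξ : EuclideanSpace ℝ (Fin d) → ℝ) : VelocityPair d :=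
  ⟨∇ ξ, tangentialGradient Ω ξ⟩

theorem memLp_gradientPair_inner (hΩ : IsSmoothDomain Ω) (hρ : IsDensityPair Ω ω γ)
    {ξ : EuclideanSpace ℝ (Fin d) → ℝ} (hξ : ContDiff ℝ (⊤ : ℕ∞) ξ) :
    MemLp (gradientPair Ω ξ).inner 2 (bulkMass Ω ω) :=
  hΩ.memLp_gradient hρ hξ

theorem memLp_gradientPair_bdry (hΩ : IsSmoothDomain Ω) (hρ : IsDensityPair Ω ω γ)
    {ξ : EuclideanSpace ℝ (Fin d) → ℝ} (hξ : ContDiff ℝ (⊤ : ℕ∞) ξ) :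
    MemLp (gradientPair Ω ξ).bdry 2 (surfaceMass Ω γ) :=
  hΩ.memLp_tangentialGradient hρ hξ

theorem toField_gradientPair_mem (hΩ : IsSmoothDomain Ω) (hρ : IsDensityPair Ω ω γ)
    {ξ : EuclideanSpace ℝ (Fin d) → ℝ} (hξ : ContDiff ℝ (⊤ : ℕ∞) ξ) :
    (gradientPair Ω ξ).toField a (memLp_gradientPair_inner hΩ hρ hξ)
        (memLp_gradientPair_bdry hΩ hρ hξ)
      ∈ gradients Ω ω γ a :=
  ⟨ξ, hξ, (hΩ.memLp_gradient hρ hξ).coeFn_toLp,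
    ((hΩ.memLp_tangentialGradient hρ hξ).smul_measure ENNReal.ofReal_ne_top).coeFn_toLp⟩

theorem exists_of_mem_gradients (hΩ : IsSmoothDomain Ω) (hρ : IsDensityPair Ω ω γ)
    {x : FieldSpace Ω ω γ a} (hx : x ∈ gradients Ω ω γ a) :
    ∃ (ξ : EuclideanSpace ℝ (Fin d) → ℝ) (hξ : ContDiff ℝ (⊤ : ℕ∞) ξ),
      x = (gradientPair Ω ξ).toField a (memLp_gradientPair_inner hΩ hρ hξ)
        (memLp_gradientPair_bdry hΩ hρ hξ) := by
  obtain ⟨ξ, hξ, h1, h2⟩ := hx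
  refine ⟨ξ, hξ, (WithLp.equiv 2 _).injective (Prod.ext ?_ ?_)⟩
  · exact Lp.ext (h1.trans (hΩ.memLp_gradient hρ hξ).coeFn_toLp.symm)
  · exact Lp.ext (h2.trans
      ((hΩ.memLp_tangentialGradient hρ hξ).smul_measure ENNReal.ofReal_ne_top).coeFn_toLp.symm)

theorem memLp_of_smul_measure (ha : 0 < a) {F : Type*} [NormedAddCommGroup F]
    {f : EuclideanSpace ℝ (Fin d) → F}
    (h : MemLp f 2 (ENNReal.ofReal a • surfaceMass Ω γ)) : MemLp f 2 (surfaceMass Ω γ) := by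
  have h1 := h.smul_measure (c := (ENNReal.ofReal a)⁻¹)
    (ENNReal.inv_ne_top.2 (ENNReal.ofReal_pos.2 ha).ne')
  rwa [smul_smul, ENNReal.inv_mul_cancel (ENNReal.ofReal_pos.2 ha).ne' ENNReal.ofReal_ne_top,
    one_smul] at h1

theorem tendsto_toField_iff (ha : 0 < a) {H : ℕ → VelocityPair d} {G : VelocityPair d}
    (hH : ∀ n, MemLp (H n).inner 2 (bulkMass Ω ω))
    (hH' : ∀ n, MemLp (H n).bdry 2 (surfaceMass Ω γ))
    (hG : MemLp G.inner 2 (bulkMass Ω ω)) (hG' : MemLp G.bdry 2 (surfaceMass Ω γ)) :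
    Tendsto (fun n => (H n).toField a (hH n) (hH' n)) atTop (𝓝 (G.toField a hG hG')) ↔
      Tendsto (fun n => eLpNorm (fun x => (H n).inner x - G.inner x) 2 (bulkMass Ω ω))
        atTop (𝓝 0) ∧
      Tendsto (fun n => eLpNorm (fun x => (H n).bdry x - G.bdry x) 2 (surfaceMass Ω γ))
        atTop (𝓝 0) := by
  set c : ℝ≥0∞ := ENNReal.ofReal a ^ (1 / (2 : ℝ≥0∞)).toReal with hc
  have hc0 : c ≠ 0 := (ENNReal.rpow_pos (ENNReal.ofReal_pos.2 ha) ENNReal.ofReal_ne_top).ne'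
  have hctop : c ≠ ∞ := by
    rw [hc]
    finiteness
  have hscale : Tendsto (fun n => eLpNorm (fun x => (H n).bdry x - G.bdry x) 2
      (ENNReal.ofReal a • surfaceMass Ω γ)) atTop (𝓝 0) ↔
      Tendsto (fun n => eLpNorm (fun x => (H n).bdry x - G.bdry x) 2 (surfaceMass Ω γ))
        atTop (𝓝 0) := by
    simp only [eLpNorm_smul_measure_of_ne_top ENNReal.ofNat_ne_top, smul_eq_mul]
    constructor
    · intro h
      have := ENNReal.Tendsto.const_mul (a := c⁻¹) h (Or.inr (ENNReal.inv_ne_top.2 hc0))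
      simpa only [← mul_assoc, ← hc, ENNReal.inv_mul_cancel hc0 hctop, one_mul, mul_zero]
        using this
    · intro h
      simpa only [mul_zero] using ENNReal.Tendsto.const_mul h (Or.inr hctop)
  rw [← hscale]
  have h1 := Lp.tendsto_Lp_iff_tendsto_eLpNorm'' (fi := atTop) (fun n => (H n).inner) hH _ hG
  have h2 := Lp.tendsto_Lp_iff_tendsto_eLpNorm'' (fi := atTop) (fun n => (H n).bdry)
    (fun n => (hH' n).smul_measure (ENNReal.ofReal_ne_top (r := a))) _
    (hG'.smul_measure (ENNReal.ofReal_ne_top (r := a)))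
  refine Iff.trans ?_ (h1.and h2)
  constructor
  · intro h
    exact ⟨((WithLp.continuous_fst 2 _ _).tendsto _).comp h,
      ((WithLp.continuous_snd 2 _ _).tendsto _).comp h⟩
  · rintro ⟨h, h'⟩
    exact ((WithLp.prod_continuous_toLp 2 _ _).tendsto _).comp (h.prodMk_nhds h')

theorem HasEnergyGradient.toField_mem_closure (ha : 0 < a) (hΩ : IsSmoothDomain Ω)
    (hρ : IsDensityPair Ω ω γ) {φ : EuclideanSpace ℝ (Fin d) → ℝ} {G : VelocityPair d}
    (h : HasEnergyGradient Ω ω γ φ G) :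
    G.toField a h.memLp_gradient h.memLp_tangentialGradient
      ∈ (gradients Ω ω γ a).topologicalClosure := by
  obtain ⟨ξ, hξ, -, -, hgrad, htan⟩ := h.approx
  have hlim := (tendsto_toField_iff (H := fun n => gradientPair Ω (ξ n)) ha
    (fun n => memLp_gradientPair_inner hΩ hρ (hξ n)) (fun n => memLp_gradientPair_bdry hΩ hρ (hξ n))
    h.memLp_gradient h.memLp_tangentialGradient).2 ⟨hgrad, htan⟩
  exact mem_closure_of_tendsto hlim
    (Eventually.of_forall fun n => toField_gradientPair_mem hΩ hρ (hξ n))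

theorem exists_eq_toField (ha : 0 < a) (g : FieldSpace Ω ω γ a) :
    ∃ (G : VelocityPair d) (hG : MemLp G.inner 2 (bulkMass Ω ω))
      (hG' : MemLp G.bdry 2 (surfaceMass Ω γ)), g = G.toField a hG hG' := by
  have h1 : MemLp g.fst 2 (bulkMass Ω ω) := Lp.memLp _
  have h2 : MemLp g.snd 2 (ENNReal.ofReal a • surfaceMass Ω γ) := Lp.memLp _
  refine ⟨⟨g.fst, g.snd⟩, h1, memLp_of_smul_measure ha h2,
    (WithLp.equiv 2 _).injective (Prod.ext ?_ ?_)⟩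
  · exact (Lp.toLp_coeFn g.fst h1).symm
  · exact (Lp.toLp_coeFn g.snd h2).symm

theorem exists_approx_of_mem_closure (ha : 0 < a) (hΩ : IsSmoothDomain Ω)
    (hρ : IsDensityPair Ω ω γ) {g : FieldSpace Ω ω γ a}
    (hg : g ∈ (gradients Ω ω γ a).topologicalClosure) :
    ∃ (G : VelocityPair d) (hG : MemLp G.inner 2 (bulkMass Ω ω))
      (hG' : MemLp G.bdry 2 (surfaceMass Ω γ)), g = G.toField a hG hG' ∧
      ∃ ξ : ℕ → EuclideanSpace ℝ (Fin d) → ℝ, (∀ n, ContDiff ℝ (⊤ : ℕ∞) (ξ n)) ∧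
        Tendsto (fun n => eLpNorm (fun x => ∇ (ξ n) x - G.inner x) 2 (bulkMass Ω ω))
          atTop (𝓝 0) ∧
        Tendsto (fun n => eLpNorm (fun x => tangentialGradient Ω (ξ n) x - G.bdry x) 2
          (surfaceMass Ω γ)) atTop (𝓝 0) := by
  obtain ⟨G, hG, hG', rfl⟩ := exists_eq_toField ha g
  obtain ⟨x, hx, hlim⟩ := mem_closure_iff_seq_limit.1 hg
  choose ξ hξ hxξ using fun n => exists_of_mem_gradients hΩ hρ (hx n)
  refine ⟨G, hG, hG', rfl, ξ, hξ, ?_⟩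
  rw [funext hxξ] at hlim
  exact (tendsto_toField_iff ha (fun n => memLp_gradientPair_inner hΩ hρ (hξ n))
    (fun n => memLp_gradientPair_bdry hΩ hρ (hξ n)) hG hG').1 hlim

/-- A subsequence of the smooth tangential gradients converges a.e., and each tangent space is
closed. Positivity of `γ` transfers the conclusion from `γσ` to `σ`. -/
theorem HasEnergyGradient.ae_mem_boundaryTangent (hΩ : IsSmoothDomain Ω)
    (hρ : IsDensityPair Ω ω γ) {φ : EuclideanSpace ℝ (Fin d) → ℝ} {G : VelocityPair d}
    (h : HasEnergyGradient Ω ω γ φ G) : ∀ᵐ x ∂(surface Ω), G.bdry x ∈ boundaryTangent Ω x := by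
  obtain ⟨ξ, hξ, -, -, -, htan⟩ := h.approx
  have hm := tendstoInMeasure_of_tendsto_eLpNorm two_ne_zero
    (fun n => (hΩ.memLp_tangentialGradient hρ (hξ n)).1) h.memLp_tangentialGradient.1 htan
  obtain ⟨ns, -, hns⟩ := hm.exists_seq_tendsto_ae
  refine hρ.surface_absolutelyContinuous.ae_le (hns.mono fun x hx => ?_)
  exact (Submodule.closed_of_finiteDimensional (boundaryTangent Ω x)).mem_of_tendsto hx
    (Eventually.of_forall fun n => tangentialGradient_mem _ _)

theorem bulkPairing_add_surfacePairing (ha : 0 < a) (hΩ : IsSmoothDomain Ω)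
    (hρ : IsDensityPair Ω ω γ) {G : VelocityPair d} (hG : MemLp G.inner 2 (bulkMass Ω ω))
    (hG' : MemLp G.bdry 2 (surfaceMass Ω γ)) {ξ : EuclideanSpace ℝ (Fin d) → ℝ}
    (hξ : ContDiff ℝ (⊤ : ℕ∞) ξ) :
    bulkPairing Ω ω ⟨G.inner, fun x => a • G.bdry x⟩ ξ
        + surfacePairing Ω γ ⟨G.inner, fun x => a • G.bdry x⟩ ξ
      = inner ℝ (G.toField a hG hG') ((gradientPair Ω ξ).toField a (memLp_gradientPair_inner hΩ hρ hξ)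
        (memLp_gradientPair_bdry hΩ hρ hξ)) := by
  rw [inner_toField ha]
  simp only [bulkPairing, surfacePairing, real_inner_smul_left, integral_const_mul]
  rfl

/-- The interior and boundary equations hold as soon as their sum does. -/
theorem represents_of_forall_add {s : Perturbation Ω} {V : VelocityPair d}
    (h : Integrable V.inner (bulkMass Ω ω)) (h' : Integrable V.bdry (surfaceMass Ω γ))
    (ht : ∀ᵐ x ∂(surface Ω), V.bdry x ∈ boundaryTangent Ω x)
    (heq : ∀ (ξ : EuclideanSpace ℝ (Fin d) → ℝ) (hξ : ContDiff ℝ (⊤ : ℕ∞) ξ),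
      s.interior (restrictTo Ω ξ hξ) + s.boundary (restrictTo (frontier Ω) ξ hξ)
        = bulkPairing Ω ω V ξ + surfacePairing Ω γ V ξ) : Represents Ω ω γ s V := by
  refine ⟨h, h', ht, fun ξ hξ _ hsupp => ?_, fun ξ hξ => by linarith [heq ξ hξ]⟩
  -- A test function supported in the interior vanishes near the boundary with its derivative, so
  -- both boundary terms drop out of the sum.
  have hfront : ∀ x ∈ frontier Ω, x ∉ tsupport ξ := fun x hx hxs => hx.2 (hsupp hxs)
  have h0 : restrictTo (frontier Ω) ξ hξ = 0 :=
    Subtype.ext (funext fun x => image_eq_zero_of_notMem_tsupport (f := ξ) (hfront x x.2))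
  have hsurf : surfacePairing Ω γ V ξ = 0 := by
    refine integral_eq_zero_of_ae (surfaceMass_absolutelyContinuous.ae_le ?_)
    filter_upwards [ae_restrict_mem isClosed_frontier.measurableSet] with x hx
    have hfd : fderiv ℝ ξ x = 0 :=
      image_eq_zero_of_notMem_tsupport fun hx' => hfront x hx (tsupport_fderiv_subset ℝ hx')
    have : tangentialGradient Ω ξ x = 0 := by
      rw [tangentialGradient, gradient, hfd, map_zero, map_zero]
    rw [this, inner_zero_right, Pi.zero_apply]
  have := heq ξ hξ
  rw [h0, map_zero, hsurf] at this
  simpa using this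

theorem Represents.add_eq {s : Perturbation Ω} {V : VelocityPair d}
    (h : Represents Ω ω γ s V) (ξ : EuclideanSpace ℝ (Fin d) → ℝ) (hξ : ContDiff ℝ (⊤ : ℕ∞) ξ) :
    s.interior (restrictTo Ω ξ hξ) + s.boundary (restrictTo (frontier Ω) ξ hξ)
      = bulkPairing Ω ω V ξ + surfacePairing Ω γ V ξ := by
  linarith [h.boundary_eq ξ hξ]

/-- The boundary weight is `(1 / a) * a ^ 2 = a`. -/
theorem kineticEnergy_smul (ha : 0 < a) (G : VelocityPair d) :
    kineticEnergy Ω ω γ a ⟨G.inner, fun x => a • G.bdry x⟩ = potentialEnergy Ω ω γ a G := by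
  have h0 : ENNReal.ofReal a ≠ 0 := (ENNReal.ofReal_pos.2 ha).ne'
  simp only [kineticEnergy, potentialEnergy, enorm_smul, mul_pow]
  congr 1
  rw [lintegral_const_mul' _ _ (by finiteness), ← mul_assoc, Real.enorm_of_nonneg ha.le, one_div,
    ENNReal.ofReal_inv_of_pos ha, pow_two, ← mul_assoc,
    ENNReal.inv_mul_cancel h0 ENNReal.ofReal_ne_top, one_mul]

/-- A pair of finite kinetic energy is `(G_o, a G_∂)` for a square-integrable pair `G`. -/
theorem Represents.exists_memLp (ha : 0 < a) {s : Perturbation Ω} {V : VelocityPair d}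
    (h : Represents Ω ω γ s V) (hfin : kineticEnergy Ω ω γ a V < ∞) :
    ∃ G : VelocityPair d, MemLp G.inner 2 (bulkMass Ω ω) ∧ MemLp G.bdry 2 (surfaceMass Ω γ) ∧
      V = ⟨G.inner, fun x => a • G.bdry x⟩ := by
  obtain ⟨h1, h2⟩ := ENNReal.add_lt_top.1 hfin
  refine ⟨⟨V.inner, fun x => a⁻¹ • V.bdry x⟩, memLp_two_of_lintegral h.integrable_inner.1 h1,
    (memLp_two_of_lintegral h.integrable_bdry.1 ?_).const_smul a⁻¹, ?_⟩
  · refine (ENNReal.mul_lt_top_iff.1 h2).elim And.right ?_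
    rintro (h0 | h0)
    · exact absurd h0 (ENNReal.ofReal_pos.2 (by positivity)).ne'
    · rw [h0]
      exact ENNReal.zero_lt_top
  · simp only [smul_smul, mul_inv_cancel₀ ha.ne', one_smul]

/-- Both fields have the same inner product with each gradient pair, namely the action of `s` on the
test function. -/
theorem sub_mem_orthogonal_gradients (ha : 0 < a) (hΩ : IsSmoothDomain Ω)
    (hρ : IsDensityPair Ω ω γ) {s : Perturbation Ω} {G H : VelocityPair d}
    (hG : MemLp G.inner 2 (bulkMass Ω ω)) (hG' : MemLp G.bdry 2 (surfaceMass Ω γ))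
    (hH : MemLp H.inner 2 (bulkMass Ω ω)) (hH' : MemLp H.bdry 2 (surfaceMass Ω γ))
    (hGs : Represents Ω ω γ s ⟨G.inner, fun x => a • G.bdry x⟩)
    (hHs : Represents Ω ω γ s ⟨H.inner, fun x => a • H.bdry x⟩) :
    G.toField a hG hG' - H.toField a hH hH' ∈ (gradients Ω ω γ a).topologicalClosureᗮ := by
  rw [Submodule.orthogonal_closure, Submodule.mem_orthogonal']
  intro x hx
  obtain ⟨ξ, hξ, rfl⟩ := exists_of_mem_gradients hΩ hρ hx
  rw [inner_sub_left, ← bulkPairing_add_surfacePairing ha hΩ hρ hG hG' hξ,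
    ← bulkPairing_add_surfacePairing ha hΩ hρ hH hH' hξ, ← hGs.add_eq ξ hξ, ← hHs.add_eq ξ hξ,
    sub_self]

theorem exists_isEllipticSolution (hd : 1 ≤ d) (ha : 0 < a) (hΩ : IsSmoothDomain Ω)
    (hρ : IsDensityPair Ω ω γ) {s : Perturbation Ω} {V : VelocityPair d}
    (hV : Represents Ω ω γ s V) (hfin : kineticEnergy Ω ω γ a V < ∞) :
    ∃ φ G, IsEllipticSolution Ω ω γ a s φ G := by
  obtain ⟨H, hH, hH', rfl⟩ := hV.exists_memLp ha hfin
  set K := (gradients Ω ω γ a).topologicalClosure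
  have : CompleteSpace K := (gradients Ω ω γ a).isClosed_topologicalClosure.completeSpace_coe
  set v := H.toField a hH hH' with hv
  have hgK : K.starProjection v ∈ K := K.starProjection_apply_mem v
  -- The discarded component is orthogonal to all gradients, so the projection represents `s` just
  -- as `v` does.
  have horth : v - K.starProjection v ∈ Kᗮ := K.sub_starProjection_mem_orthogonal v
  obtain ⟨G, hG, hG', hgG, ξ, hξ, hgrad, htan⟩ := exists_approx_of_mem_closure ha hΩ hρ hgK
  obtain ⟨φ, hφ⟩ := exists_hasEnergyGradient hd hΩ hρ hG hG' hξ hgrad htan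
  have := hρ.isFiniteMeasure_bulkMass
  have := hρ.isFiniteMeasure_surfaceMass
  refine ⟨φ, G, hφ, represents_of_forall_add (hG.integrable one_le_two)
    ((hG'.integrable one_le_two).smul a) ?_ fun η hη => ?_⟩
  · exact (hφ.ae_mem_boundaryTangent hΩ hρ).mono fun x hx => Submodule.smul_mem _ _ hx
  · rw [hV.add_eq η hη, bulkPairing_add_surfacePairing ha hΩ hρ hG hG' hη,
      bulkPairing_add_surfacePairing ha hΩ hρ hH hH' hη, ← sub_eq_zero, ← inner_sub_left, ← hgG]
    exact Submodule.inner_left_of_mem_orthogonal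
      (Submodule.le_topologicalClosure _ (toField_gradientPair_mem hΩ hρ hη)) horth

/-- The difference lies both in the closure of the gradients and in its orthogonal complement. -/
theorem IsEllipticSolution.toField_eq (ha : 0 < a) (hΩ : IsSmoothDomain Ω)
    (hρ : IsDensityPair Ω ω γ) {s : Perturbation Ω} {φ ψ : EuclideanSpace ℝ (Fin d) → ℝ}
    {G H : VelocityPair d} (h : IsEllipticSolution Ω ω γ a s φ G)
    (h' : IsEllipticSolution Ω ω γ a s ψ H) :
    G.toField a h.1.memLp_gradient h.1.memLp_tangentialGradient
      = H.toField a h'.1.memLp_gradient h'.1.memLp_tangentialGradient := by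
  rw [← sub_eq_zero, ← inner_self_eq_zero (𝕜 := ℝ)]
  exact Submodule.inner_right_of_mem_orthogonal
    (Submodule.sub_mem _ (h.1.toField_mem_closure ha hΩ hρ) (h'.1.toField_mem_closure ha hΩ hρ))
    (sub_mem_orthogonal_gradients ha hΩ hρ _ _ _ _ h.2 h'.2)

theorem IsEllipticSolution.exists_ae_eq_add_const (hd : 1 ≤ d) (ha : 0 < a)
    (hΩ : IsSmoothDomain Ω) (hρ : IsDensityPair Ω ω γ) {s : Perturbation Ω}
    {φ ψ : EuclideanSpace ℝ (Fin d) → ℝ} {G H : VelocityPair d}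
    (h : IsEllipticSolution Ω ω γ a s φ G) (h' : IsEllipticSolution Ω ω γ a s ψ H) :
    ∃ c : ℝ, ψ =ᵐ[bulk Ω + surface Ω] fun x => φ x + c := by
  have heq := congrArg WithLp.fst (h'.toField_eq ha hΩ hρ h)
  have hae : H.inner =ᵐ[bulkMass Ω ω] G.inner :=
    (MemLp.toLp_eq_toLp_iff h'.1.memLp_gradient h.1.memLp_gradient).1 heq
  obtain ⟨c, hc⟩ := (h'.1.sub hΩ hρ h.1).exists_ae_eq_const hd hΩ hρ
    (hae.mono fun x hx => by simp [hx])
  exact ⟨c, hc.mono fun x hx => by simp only at hx; linarith⟩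

/-- Pythagoras: a competitor of finite energy differs from the solution's field by something
orthogonal to it. Competitors of infinite energy are trivial. -/
theorem IsEllipticSolution.isLeast (ha : 0 < a) (hΩ : IsSmoothDomain Ω)
    (hρ : IsDensityPair Ω ω γ) {s : Perturbation Ω} {φ : EuclideanSpace ℝ (Fin d) → ℝ}
    {G : VelocityPair d} (h : IsEllipticSolution Ω ω γ a s φ G) :
    IsLeast {e : ℝ≥0∞ | ∃ V : VelocityPair d,
      Represents Ω ω γ s V ∧ e = kineticEnergy Ω ω γ a V} (potentialEnergy Ω ω γ a G) := by
  refine ⟨⟨_, h.2, (kineticEnergy_smul ha G).symm⟩, ?_⟩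
  rintro _ ⟨V, hV, rfl⟩
  by_cases hfin : kineticEnergy Ω ω γ a V < ∞
  swap
  · rw [not_lt_top_iff.1 hfin]
    exact le_top
  obtain ⟨H, hH, hH', rfl⟩ := hV.exists_memLp ha hfin
  rw [kineticEnergy_smul ha, ← enorm_toField_sq hH hH',
    ← enorm_toField_sq h.1.memLp_gradient h.1.memLp_tangentialGradient]
  set g := G.toField a h.1.memLp_gradient h.1.memLp_tangentialGradient
  set v := H.toField a hH hH'
  have horth : inner ℝ g (v - g) = 0 :=
    Submodule.inner_right_of_mem_orthogonal (h.1.toField_mem_closure ha hΩ hρ)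
      (sub_mem_orthogonal_gradients ha hΩ hρ _ _ _ _ hV h.2)
  have hnorm : ‖g‖ ≤ ‖v‖ := by
    have h1 := norm_add_sq_eq_norm_sq_add_norm_sq_of_inner_eq_zero g (v - g) horth
    rw [add_sub_cancel] at h1
    nlinarith [norm_nonneg g, norm_nonneg v, norm_nonneg (v - g)]
  gcongr
  rw [← ofReal_norm, ← ofReal_norm]
  exact ENNReal.ofReal_le_ofReal hnorm

theorem IsEllipticSolution.add_const (hd : 1 ≤ d) (hΩ : IsSmoothDomain Ω)
    {s : Perturbation Ω} {φ ψ : EuclideanSpace ℝ (Fin d) → ℝ} {G : VelocityPair d}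
    (h : IsEllipticSolution Ω ω γ a s φ G) {c : ℝ}
    (hψ : ψ =ᵐ[bulk Ω + surface Ω] fun x => φ x + c) : IsEllipticSolution Ω ω γ a s ψ G :=
  ⟨h.1.add_const hd hΩ hψ, h.2⟩

end EnergySpace

end Wentzell

theorem mainTheorem5 {d : ℕ} (hd : 2 ≤ d) (Ω : Set (EuclideanSpace ℝ (Fin d)))
    (hΩ : Wentzell.IsSmoothDomain Ω) (ω γ : EuclideanSpace ℝ (Fin d) → ℝ)
    (hρ : Wentzell.IsDensityPair Ω ω γ) (a : ℝ) (ha : 0 < a) (s : Wentzell.Perturbation Ω)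
    (hs : ∃ V : Wentzell.VelocityPair d,
      Wentzell.Represents Ω ω γ s V ∧ Wentzell.kineticEnergy Ω ω γ a V < ∞) :
    (∃ (φ : EuclideanSpace ℝ (Fin d) → ℝ) (G : Wentzell.VelocityPair d),
      Wentzell.IsEllipticSolution Ω ω γ a s φ G) ∧
    ∀ (φ : EuclideanSpace ℝ (Fin d) → ℝ) (G : Wentzell.VelocityPair d),
      Wentzell.IsEllipticSolution Ω ω γ a s φ G →
        IsLeast {e : ℝ≥0∞ | ∃ V : Wentzell.VelocityPair d,
            Wentzell.Represents Ω ω γ s V ∧ e = Wentzell.kineticEnergy Ω ω γ a V}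
          (Wentzell.potentialEnergy Ω ω γ a G) ∧
        ∀ ψ : EuclideanSpace ℝ (Fin d) → ℝ,
          (∃ H : Wentzell.VelocityPair d, Wentzell.IsEllipticSolution Ω ω γ a s ψ H) ↔
            ∃ c : ℝ, ψ =ᵐ[Wentzell.bulk Ω + Wentzell.surface Ω] fun x => φ x + c := by
  have hd1 : 1 ≤ d := by omega
  obtain ⟨V, hV, hfin⟩ := hs
  refine ⟨Wentzell.exists_isEllipticSolution hd1 ha hΩ hρ hV hfin, fun φ G h =>
    ⟨h.isLeast ha hΩ hρ, fun ψ => ⟨?_, ?_⟩⟩⟩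
  · rintro ⟨H, h'⟩
    exact h.exists_ae_eq_add_const hd1 ha hΩ hρ h'
  · rintro ⟨c, hc⟩
    exact ⟨G, h.add_const hd1 hΩ hc⟩
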